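/- Let $q$ be a prime power, let $m\ge 0$ and $n=2m+1$, and let $\mathbb F=\mathbb F_{q^2}$, with $\bar a=a^q$ for $a\in\mathbb F$; for a matrix $N$ let $\bar N$ be the matrix obtained by conjugating all entries. Let $J_n$ be the $n\times n$ matrix with ones on the antidiagonal and zeros elsewhere, and let $$GU(n,q^2)=\{N\in GL_n(\mathbb F) : N^TJ_n\bar N=J_n\}.$$ Let $G$ be the subgroup of $GU(n,q^2)$ consisting of its lower triangular matrices with ones on the diagonal (the explicit Sylow subgroup for the characteristic of $\mathbb F$). Let $V=\mathbb F^n$, let $x_1,\dots,x_n$ be the basis of $V^*$ dual to the standard basis, and let $GL_n(\mathbb F)$ act on $\mathbb F[V]=\mathbb F[x_1,\dots,x_n]$ by $(g\cdot f)(v)=f(g^{-1}v)$ and, by extension, on its quotient field $\mathbb F(V)$. For each $j$ let $N(x_j)$ be the product of all elements of the $G$-orbit of $x_j$, and for $k\ge 1$ let $$h_k=\Lambda_{k,1}=\sum_{i=1}^m\left(x_{n-i+1}^{q^{2k-1}}x_i+x_{n-i+1}x_i^{q^{2k-1}}\right)+x_{m+1}^{q^{2k-1}+1}.$$ Then the field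 of invariant rational functions is $$\mathbb F_{q^2}(V)^G=\mathbb F_{q^2}\bigl(x_1,N(x_2),\dots,N(x_{m+1}),h_1,\dots,h_m\bigr).$$ -/

import Mathlib

/-! Variables are numbered from `0`: the index `i : Fin n` stands for the variable `x_{i+1}`, and
`i.rev` stands for `x_{n-i}`. Throughout, `F` is a finite field with `q ^ 2` elements. -/

/-- If a finite field has `q ^ 2` elements, then `a ↦ a ^ q` is additive. -/
theorem add_pow_of_card_eq_sq {F : Type*} [Field F] [Fintype F] {q : ℕ}
    (hq : Fintype.card F = q ^ 2) (a b : F) : (a + b) ^ q = a ^ q + b ^ q := by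
  obtain ⟨p, hp⟩ := CharP.exists F
  obtain ⟨n, hpp, hn⟩ := FiniteField.card F p
  have : Fact p.Prime := ⟨hpp⟩
  have hdvd : q ∣ p ^ (n : ℕ) := by rw [← hn, hq]; exact dvd_pow_self q two_ne_zero
  obtain ⟨k, -, rfl⟩ := (Nat.dvd_prime_pow hpp).1 hdvd
  exact add_pow_char_pow a b p k

/-- The conjugation `a ↦ a ^ q` of the field with `q ^ 2` elements. -/
def conjHom {F : Type*} [Field F] [Fintype F] {q : ℕ}
    (hq : Fintype.card F = q ^ 2) : F →+* F where
  toFun a := a ^ q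
  map_one' := one_pow q
  map_mul' a b := mul_pow a b q
  map_zero' := zero_pow (by
    rintro rfl
    exact Fintype.card_ne_zero (hq.trans (by norm_num)))
  map_add' := add_pow_of_card_eq_sq hq

/-- The matrix with ones on the antidiagonal and zeros elsewhere. For `n = 2 * m + 1` it is the
block antidiagonal matrix with blocks `J_m`, `1`, `J_m`. -/
def antidiagMatrix (F : Type*) [Field F] (n : ℕ) : Matrix (Fin n) (Fin n) F :=
  Matrix.of fun i j => if j = i.rev then 1 else 0

/-- The general unitary group: all invertible `N` with `Nᵀ J N̄ = J`, where `N̄` is obtained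
from `N` by raising all entries to the power `q`. -/
def generalUnitaryGroup {F : Type*} [Field F] [Fintype F] {q : ℕ}
    (hq : Fintype.card F = q ^ 2) (n : ℕ) : Subgroup (GL (Fin n) F) where
  carrier := {N | N.1.transpose * antidiagMatrix F n * N.1.map (conjHom hq) = antidiagMatrix F n}
  one_mem' := by
    simp [Matrix.map_one]
  mul_mem' := by
    intro a b ha hb
    simp only [Set.mem_ofPred_eq] at ha hb ⊢
    rw [Units.val_mul, Matrix.transpose_mul, Matrix.map_mul]
    calc _ = b.1.transpose * (a.1.transpose * antidiagMatrix F n * a.1.map (conjHom hq)) *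
          b.1.map (conjHom hq) := by simp only [Matrix.mul_assoc]
      _ = _ := by rw [ha, hb]
  inv_mem' := by
    intro a ha
    simp only [Set.mem_ofPred_eq] at ha ⊢
    have h1 : (a⁻¹).1.transpose * a.1.transpose = 1 := by
      rw [← Matrix.transpose_mul, ← Units.val_mul, mul_inv_cancel]
      simp
    have h2 : a.1.map (conjHom hq) * (a⁻¹).1.map (conjHom hq) = 1 := by
      rw [← Matrix.map_mul, ← Units.val_mul, mul_inv_cancel]
      simp [Matrix.map_one]
    calc _ = (a⁻¹).1.transpose * (a.1.transpose * antidiagMatrix F n * a.1.map (conjHom hq)) *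
          (a⁻¹).1.map (conjHom hq) := by rw [ha]
      _ = ((a⁻¹).1.transpose * a.1.transpose) * antidiagMatrix F n *
          (a.1.map (conjHom hq) * (a⁻¹).1.map (conjHom hq)) := by simp only [Matrix.mul_assoc]
      _ = _ := by rw [h1, h2, Matrix.one_mul, Matrix.mul_one]

/-- The group of lower triangular matrices with ones along the diagonal. -/
def lowerUnitriangular (F : Type*) [Field F] (n : ℕ) : Subgroup (GL (Fin n) F) where
  carrier := {N | (∀ i, N.1 i i = 1) ∧ ∀ i j, i < j → N.1 i j = 0}
  one_mem' := ⟨fun i => by simp, fun i j h => by simp [Matrix.one_apply_ne h.ne]⟩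
  mul_mem' := by
    rintro a b ⟨ha, ha'⟩ ⟨hb, hb'⟩
    constructor
    · intro i
      rw [Units.val_mul, Matrix.mul_apply, Finset.sum_eq_single i]
      · rw [ha, hb, one_mul]
      · intro k _ hk
        rcases lt_or_gt_of_ne hk with h | h
        · rw [hb' k i h, mul_zero]
        · rw [ha' i k h, zero_mul]
      · simp
    · intro i j hij
      rw [Units.val_mul, Matrix.mul_apply]
      refine Finset.sum_eq_zero fun k _ => ?_
      rcases lt_or_ge i k with h | h
      · rw [ha' i k h, zero_mul]
      · rw [hb' k j (h.trans_lt hij), mul_zero]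
  inv_mem' := by
    rintro a ⟨ha, ha'⟩
    have hz : ∀ i j, i < j → (a⁻¹).1 i j = 0 := by
      intro i j hij
      have hb : Matrix.BlockTriangular a.1 OrderDual.toDual := fun i j h => ha' i j h
      have : Invertible a.1 := a.invertible
      have := Matrix.blockTriangular_inv_of_blockTriangular hb
      rw [Matrix.coe_units_inv]
      exact this hij
    refine ⟨fun i => ?_, hz⟩
    have h' : (a.1 * (a⁻¹).1) i i = 1 := by rw [← Units.val_mul, mul_inv_cancel]; simp
    rw [Matrix.mul_apply, Finset.sum_eq_single i] at h'
    · simpa [ha i] using h'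
    · intro k _ hk
      rcases lt_or_gt_of_ne hk with h | h
      · rw [hz k i h, mul_zero]
      · rw [ha' i k h, zero_mul]
    · simp

/-- The explicit Sylow subgroup: the lower unitriangular matrices in the unitary group of odd
dimension `2 * m + 1`. -/
def unitarySylow {F : Type*} [Field F] [Fintype F] {q : ℕ}
    (hq : Fintype.card F = q ^ 2) (m : ℕ) : Subgroup (GL (Fin (2 * m + 1)) F) :=
  lowerUnitriangular F (2 * m + 1) ⊓ generalUnitaryGroup hq (2 * m + 1)

/-- The substitution `x_i ↦ ∑ j, N i j * x_j`, i.e. `f ↦ (v ↦ f (N v))`. -/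
noncomputable def linSubst {F : Type*} [Field F] {n : ℕ} (N : Matrix (Fin n) (Fin n) F) :
    MvPolynomial (Fin n) F →ₐ[F] MvPolynomial (Fin n) F :=
  MvPolynomial.aeval fun i => ∑ j, MvPolynomial.C (N i j) * MvPolynomial.X j

theorem linSubst_comp {F : Type*} [Field F] {n : ℕ} (M N : Matrix (Fin n) (Fin n) F) :
    (linSubst M).comp (linSubst N) = linSubst (N * M) := by
  ext1 i
  simp only [linSubst, AlgHom.comp_apply, MvPolynomial.aeval_X, map_sum, map_mul,
    MvPolynomial.algHom_C, MvPolynomial.algebraMap_eq, Matrix.mul_apply, Finset.mul_sum,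
    Finset.sum_mul, mul_assoc]
  exact Finset.sum_comm

theorem linSubst_one {F : Type*} [Field F] {n : ℕ} :
    linSubst (1 : Matrix (Fin n) (Fin n) F) = AlgHom.id F _ := by
  ext1 i
  simp [linSubst, Matrix.one_apply]

/-- The action of the general linear group on the polynomial ring `F[V]`, `V = F ^ n`, given by
`(g • f) (v) = f (g⁻¹ v)`. -/
noncomputable def polyAction (F : Type*) [Field F] (n : ℕ) :
    GL (Fin n) F →* (MvPolynomial (Fin n) F ≃ₐ[F] MvPolynomial (Fin n) F) where
  toFun g := AlgEquiv.ofAlgHom (linSubst (g⁻¹).1) (linSubst g.1)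
    (by rw [linSubst_comp, ← Units.val_mul, mul_inv_cancel, Units.val_one, linSubst_one])
    (by rw [linSubst_comp, ← Units.val_mul, inv_mul_cancel, Units.val_one, linSubst_one])
  map_one' := by
    ext1 f
    simp [linSubst_one]
  map_mul' g h := by
    ext1 f
    simp only [AlgEquiv.ofAlgHom_apply, AlgEquiv.mul_apply, mul_inv_rev, Units.val_mul,
      ← linSubst_comp, AlgHom.comp_apply]

/-- The field `F(V)` of rational functions. -/
abbrev RatFunField (F : Type*) [Field F] (n : ℕ) : Type _ :=
  FractionRing (MvPolynomial (Fin n) F)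

/-- The field `F(V)^G` of invariant rational functions. -/
noncomputable def invariantField {F : Type*} [Field F] {n : ℕ} (G : Subgroup (GL (Fin n) F)) :
    IntermediateField F (RatFunField F n) :=
  IntermediateField.fixedField
    (G.map ((IsFractionRing.fieldEquivOfAlgEquivHom F (RatFunField F n)).comp (polyAction F n)))

/-- The orbit product `N(f)`: the product of the distinct elements of the `G`-orbit of `f`
(which is finite for the finite groups `G` considered). -/
noncomputable def orbitProduct {F : Type*} [Field F] {n : ℕ} (G : Subgroup (GL (Fin n) F))
    (f : MvPolynomial (Fin n) F) : MvPolynomial (Fin n) F :=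
  ∏ᶠ u ∈ Set.range (fun g : G => polyAction F n g f), u

/-- The polynomial `Λ_{s,c}` in `n = 2 * m + 1` variables (for `s ≥ 1`), that is
`∑_{i=1}^m (x_{n-i+1}^{q^{2s-1}} x_i + x_{n-i+1} x_i^{q^{2s-1}}) + c x_{m+1}^{q^{2s-1}+1}`. -/
noncomputable def lambdaPoly (F : Type*) [Field F] (q m s : ℕ) (c : F) :
    MvPolynomial (Fin (2 * m + 1)) F :=
  (∑ i ∈ Finset.univ.filter (fun i : Fin (2 * m + 1) => (i : ℕ) < m),
    (MvPolynomial.X i.rev ^ q ^ (2 * s - 1) * MvPolynomial.X i +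
      MvPolynomial.X i.rev * MvPolynomial.X i ^ q ^ (2 * s - 1))) +
    MvPolynomial.C c * MvPolynomial.X ⟨m, by omega⟩ ^ (q ^ (2 * s - 1) + 1)

/-- The polynomials `h_k = Λ_{k,1}`, for `k ≥ 1`. -/
noncomputable def hPoly (F : Type*) [Field F] (q m k : ℕ) :
    MvPolynomial (Fin (2 * m + 1)) F :=
  lambdaPoly F q m k 1

/-!
Let `K` be the field generated by `x_1`, the orbit products and the `h_k`, and let `L = F(V)`.
The generators are invariant: `h_k` is the form `∑ x_i x_{i'} ^ (q ^ (2 k - 1))` (with `i'` the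
reversed index), and raising coefficients to the power `q ^ (2 k - 1)` is the conjugation of `F`.
For the converse it is shown that `L / K` is separable algebraic and that every `K`-embedding of `L`
into an algebraic closure `Ω` of `L` is given by an element of `G`. An invariant `a` is then its only
conjugate over `K`, so it lies in `K`.

*Embeddings* (`exists_polyAction_of_agree`). Let `w_i ∈ Ω` be the image of `x_i`. For `j ≤ m + 1` the
orbit of `x_j` is the full coset of `x_j` modulo the span of the preceding variables
(`range_polyAction_X`), and `∏ (X + u)`, over a finite additive group, is constant precisely on
cosets; by induction `w_j - x_j` lies in the `F`-span of the `x_i` with `i < j`. With the first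
`m + 1` variables under control, the equations for the `h_k` become, after a change of unknowns,
`∑ (w_i u_i ^ (q ^ (2 k - 1)) + u_i w_i ^ (q ^ (2 k - 1))) = t ^ (q ^ (2 k - 1) + 1)` for
`1 ≤ k ≤ m`, with `t` in the span of `w_1, …, w_m`. Applying powers of the Frobenius map turns this
system into two matrix equations between the Moore matrices of `w` and `u`, which show that
`W⁻¹ U` is fixed by `a ↦ a ^ (q ^ 2)`, so that the `u_i` are `F`-linear combinations of the `w_i`
(`mem_span_of_hermitian_system`). Hence `w = N x` for a lower unitriangular matrix `N` over `F`,
and `N` is unitary since `h_1` is preserved and the `x_i` are algebraically independent.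

*Separability* (`derivation_X_eq_zero`). A `K`-derivation of `L` kills `x_1, …, x_{m + 1}`, since
`∏ (X + u)` is a separable polynomial, and then the other variables, since the differentials of the
`h_k` are linear combinations of theirs with an invertible Moore matrix of coefficients. As `L` is
finitely generated over `K`, the vanishing of all derivations means that `L / K` is separable
algebraic.
-/

/-! ### Powers of the Frobenius map over a field with `q ^ 2` elements -/

section Frobenius

variable {F : Type*} [Field F] [Fintype F] {q : ℕ}

theorem exists_prime_pow_of_card_eq_sq (hq : Fintype.card F = q ^ 2) :
    ∃ p k : ℕ, p.Prime ∧ CharP F p ∧ k ≠ 0 ∧ q = p ^ k := by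
  obtain ⟨p, hp⟩ := CharP.exists F
  obtain ⟨n, hpp, hn⟩ := FiniteField.card F p
  have hdvd : q ∣ p ^ (n : ℕ) := by rw [← hn, hq]; exact dvd_pow_self q two_ne_zero
  obtain ⟨k, -, rfl⟩ := (Nat.dvd_prime_pow hpp).1 hdvd
  refine ⟨p, k, hpp, hp, ?_, rfl⟩
  rintro rfl
  have := Fintype.one_lt_card (α := F)
  rw [hq] at this
  simp at this

theorem one_lt_of_card_eq_sq (hq : Fintype.card F = q ^ 2) : 1 < q := by
  obtain ⟨p, k, hp, -, hk, rfl⟩ := exists_prime_pow_of_card_eq_sq hq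
  exact Nat.one_lt_pow hk hp.one_lt

theorem natCast_eq_zero_of_card_eq_sq (hq : Fintype.card F = q ^ 2) : (q : F) = 0 := by
  obtain ⟨p, k, hp, hc, hk, rfl⟩ := exists_prime_pow_of_card_eq_sq hq
  simp [hk]

theorem algebra_add_pow (hq : Fintype.card F = q ^ 2) {A : Type*} [CommRing A] [Algebra F A]
    (a b : A) : (a + b) ^ q = a ^ q + b ^ q := by
  obtain ⟨p, k, hp, hc, hk, rfl⟩ := exists_prime_pow_of_card_eq_sq hq
  nontriviality A
  have : CharP A p := charP_of_injective_algebraMap (algebraMap F A).injective p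
  have : Fact p.Prime := ⟨hp⟩
  exact add_pow_char_pow a b p k

/-- The endomorphism `a ↦ a ^ q` of a commutative algebra over the field with `q ^ 2` elements. -/
def powHom (hq : Fintype.card F = q ^ 2) (A : Type*) [CommRing A] [Algebra F A] : A →+* A where
  toFun a := a ^ q
  map_one' := one_pow q
  map_mul' a b := mul_pow a b q
  map_zero' := zero_pow (by have := one_lt_of_card_eq_sq hq; omega)
  map_add' := algebra_add_pow hq

theorem powHom_apply (hq : Fintype.card F = q ^ 2) {A : Type*} [CommRing A] [Algebra F A] (a : A) :
    powHom hq A a = a ^ q := rfl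

theorem powHom_pow_apply (hq : Fintype.card F = q ^ 2) {A : Type*} [CommRing A] [Algebra F A]
    (n : ℕ) (a : A) : (powHom hq A ^ n) a = a ^ q ^ n := by
  induction n with
  | zero => simp
  | succ n ih => rw [pow_succ', RingHom.mul_def, RingHom.comp_apply, ih, powHom_apply, ← pow_mul,
      ← pow_succ]

theorem sum_pow_q_pow (hq : Fintype.card F = q ^ 2) {A : Type*} [CommRing A] [Algebra F A]
    {ι : Type*} (s : Finset ι) (f : ι → A) (n : ℕ) :
    (∑ i ∈ s, f i) ^ q ^ n = ∑ i ∈ s, f i ^ q ^ n := by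
  simp only [← powHom_pow_apply hq, map_sum]

theorem add_pow_q_pow (hq : Fintype.card F = q ^ 2) {A : Type*} [CommRing A] [Algebra F A]
    (a b : A) (n : ℕ) : (a + b) ^ q ^ n = a ^ q ^ n + b ^ q ^ n := by
  simp only [← powHom_pow_apply hq, map_add]

theorem sub_pow_q_pow (hq : Fintype.card F = q ^ 2) {A : Type*} [CommRing A] [Algebra F A]
    (a b : A) (n : ℕ) : (a - b) ^ q ^ n = a ^ q ^ n - b ^ q ^ n := by
  simp only [← powHom_pow_apply hq, map_sub]

theorem pow_q_pow_even (hq : Fintype.card F = q ^ 2) (c : F) (n : ℕ) : c ^ q ^ (2 * n) = c := by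
  rw [pow_mul, ← hq]
  exact FiniteField.pow_card_pow n c

theorem pow_q_pow_odd (hq : Fintype.card F = q ^ 2) (c : F) (n : ℕ) :
    c ^ q ^ (2 * n + 1) = c ^ q := by
  rw [pow_succ, pow_mul, pow_q_pow_even hq]

/-- The fixed field of `z ↦ z ^ (q ^ 2)` is the field with `q ^ 2` elements. -/
theorem exists_algebraMap_eq_of_pow_eq (hq : Fintype.card F = q ^ 2) {Ω : Type*} [Field Ω]
    [Algebra F Ω] {z : Ω} (hz : z ^ q ^ 2 = z) : ∃ c : F, algebraMap F Ω c = z := by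
  have hcard := Fintype.one_lt_card (α := F)
  have h : ∏ c : F, (Polynomial.X - Polynomial.C c) =
      (Polynomial.X ^ Fintype.card F - Polynomial.X : Polynomial F) := by
    have hr := FiniteField.roots_X_pow_card_sub_X F
    rw [← Polynomial.prod_multiset_X_sub_C_of_monic_of_roots_card_eq
      (Polynomial.monic_X_pow_sub (by simpa using hcard)) (by
        rw [hr, FiniteField.X_pow_card_sub_X_natDegree_eq F hcard]; rfl), hr]
    rfl
  have h2 := congrArg (Polynomial.aeval z) h
  simp only [map_prod, map_sub, Polynomial.aeval_X, Polynomial.aeval_C, map_pow, hq, hz,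
    sub_self] at h2
  obtain ⟨c, -, hc⟩ := Finset.prod_eq_zero_iff.1 h2
  exact ⟨c, (sub_eq_zero.1 hc).symm⟩

/-- The trace of the field with `q ^ 2` elements over its subfield with `q` elements takes the
value `1`. -/
theorem exists_add_pow_eq_one (hq : Fintype.card F = q ^ 2) : ∃ c : F, c + c ^ q = 1 := by
  have hq1 := one_lt_of_card_eq_sq hq
  obtain ⟨b, hb⟩ : ∃ b : F, b + b ^ q ≠ 0 := by
    by_contra! h
    have hdeg : (Polynomial.X ^ q + Polynomial.X : Polynomial F).natDegree = q := by
      rw [Polynomial.natDegree_add_eq_left_of_natDegree_lt] <;> simp [hq1]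
    have hz : (Polynomial.X ^ q + Polynomial.X : Polynomial F) = 0 := by
      refine Polynomial.eq_zero_of_natDegree_lt_card_of_eval_eq_zero _ (f := id)
        Function.injective_id (fun a => ?_) ?_
      · simpa [add_comm] using h a
      · rw [hdeg, hq]; nlinarith
    rw [hz] at hdeg
    simp at hdeg
    omega
  have hfix : (b + b ^ q) ^ q = b + b ^ q := by
    rw [add_pow_of_card_eq_sq hq, ← pow_mul, ← sq, ← hq, FiniteField.pow_card, add_comm]
  refine ⟨b / (b + b ^ q), ?_⟩
  rw [div_pow, hfix, ← add_div, div_self hb]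

end Frobenius

/-! ### Moore matrices -/

section Moore

variable {F : Type*} [Field F] [Fintype F] {q : ℕ} {Ω : Type*} [Field Ω] [Algebra F Ω] {m : ℕ}

/-- The Moore matrix, with entries `w_i ^ (q ^ (2 a))` in row `a` and column `i`. -/
def mooreMatrix (q : ℕ) (w : Fin m → Ω) : Matrix (Fin m) (Fin m) Ω :=
  Matrix.of fun a i => w i ^ q ^ (2 * (a : ℕ))

/-- A vanishing combination of the rows of the Moore matrix is a polynomial of degree at most
`q ^ (2 * (m - 1))` that vanishes on the `q ^ (2 * m)` elements of the span of the `w_i`. -/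
theorem det_mooreMatrix_ne_zero (hq : Fintype.card F = q ^ 2) {w : Fin m → Ω}
    (hw : LinearIndependent F w) : (mooreMatrix q w).det ≠ 0 := by
  classical
  have hq1 := one_lt_of_card_eq_sq hq
  intro hdet
  obtain ⟨c, hc0, hc⟩ := Matrix.exists_vecMul_eq_zero_iff.2 hdet
  have hm : 0 < m := by
    rcases Nat.eq_zero_or_pos m with rfl | h
    · exact absurd (Subsingleton.elim _ _) hc0
    · exact h
  let P : Polynomial Ω := ∑ a : Fin m, Polynomial.monomial (q ^ (2 * (a : ℕ))) (c a)
  have hcoeff : ∀ a : Fin m, P.coeff (q ^ (2 * (a : ℕ))) = c a := by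
    intro a
    simp only [P, Polynomial.finsetSum_coeff, Polynomial.coeff_monomial]
    rw [Finset.sum_eq_single a]
    · simp
    · intro b _ hb
      rw [if_neg]
      intro h
      have := Nat.pow_right_injective hq1 h
      exact hb (Fin.ext (by omega))
    · simp
  have hdeg : P.natDegree ≤ q ^ (2 * (m - 1)) := by
    refine Polynomial.natDegree_sum_le_of_forall_le _ _ fun a _ => ?_
    refine (Polynomial.natDegree_monomial_le _).trans ?_
    exact Nat.pow_le_pow_right (by omega) (by omega)
  have hP : P = 0 := by
    refine Polynomial.eq_zero_of_natDegree_lt_card_of_eval_eq_zero P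
      (f := fun d : Fin m → F => ∑ i, d i • w i) ?_ (fun d => ?_) ?_
    · exact linearIndependent_iff_injective_fintypeLinearCombination.1 hw
    · simp only [P, Polynomial.eval_finsetSum, Polynomial.eval_monomial]
      have : ∀ a : Fin m, c a * (∑ i, d i • w i) ^ q ^ (2 * (a : ℕ)) =
          ∑ i, d i • (c a * w i ^ q ^ (2 * (a : ℕ))) := by
        intro a
        rw [sum_pow_q_pow hq, Finset.mul_sum]
        refine Finset.sum_congr rfl fun i _ => ?_
        rw [smul_pow, pow_q_pow_even hq, mul_smul_comm]
      simp only [this]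
      rw [Finset.sum_comm]
      refine Finset.sum_eq_zero fun i _ => ?_
      rw [← Finset.smul_sum]
      have hi := congrFun hc i
      simp only [Matrix.vecMul, dotProduct, mooreMatrix, Matrix.of_apply, Pi.zero_apply] at hi
      rw [hi, smul_zero]
    · refine hdeg.trans_lt ?_
      rw [Fintype.card_fun, Fintype.card_fin, hq, ← pow_mul]
      exact Nat.pow_lt_pow_right hq1 (by omega)
  apply hc0
  funext a
  rw [← hcoeff a, hP]
  simp

/-- The equations say that `W U'ᵀ + U W'ᵀ = W S W'ᵀ`, where `W` and `U` are the Moore matrices of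
`w` and `u`, the prime raises all entries to the power `q`, and `t = ∑ s_i w_i`,
`S_{ij} = s_i s_j ^ q`; symmetry gives the same equation with `W`, `U` on the left replaced by
their entrywise powers `W''`, `U''` with exponent `q ^ 2`.  Hence `W⁻¹ U = W''⁻¹ U''`, so that the
entries of `W⁻¹ U` lie in `F`. -/
theorem mem_span_of_hermitian_system (hq : Fintype.card F = q ^ 2) {w u : Fin m → Ω} {t : Ω}
    (hw : LinearIndependent F w) (ht : t ∈ Submodule.span F (Set.range w))
    (h : ∀ k, 1 ≤ k → k ≤ m → ∑ i, (w i * u i ^ q ^ (2 * k - 1) + u i * w i ^ q ^ (2 * k - 1)) =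
      t * t ^ q ^ (2 * k - 1)) (l : Fin m) :
    u l ∈ Submodule.span F (Set.range w) := by
  classical
  obtain ⟨s, hs⟩ := (Submodule.mem_span_range_iff_exists_fun F).1 ht
  have hs' : ∀ n, t ^ q ^ n = ∑ i, algebraMap F Ω (s i ^ q ^ n) * w i ^ q ^ n := by
    intro n
    rw [← hs, sum_pow_q_pow hq]
    refine Finset.sum_congr rfl fun i _ => ?_
    rw [Algebra.smul_def, mul_pow, map_pow]
  have key : ∀ a b k : ℕ, 1 ≤ k → k ≤ m → b = a + (2 * k - 1) →
      ∑ i, (w i ^ q ^ a * u i ^ q ^ b + u i ^ q ^ a * w i ^ q ^ b) = t ^ q ^ a * t ^ q ^ b := by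
    rintro a b k hk1 hkm rfl
    have := congrArg (fun z => z ^ q ^ a) (h k hk1 hkm)
    simp only [sum_pow_q_pow hq, add_pow_q_pow hq, mul_pow, ← pow_mul, ← pow_add] at this
    simpa only [add_comm a, ← pow_add] using this
  have key2 : ∀ a b k : ℕ, 1 ≤ k → k ≤ m → (b = a + (2 * k - 1) ∨ a = b + (2 * k - 1)) →
      ∑ i, (w i ^ q ^ a * u i ^ q ^ b + u i ^ q ^ a * w i ^ q ^ b) = t ^ q ^ a * t ^ q ^ b := by
    rintro a b k hk1 hkm (hb | ha)
    · exact key a b k hk1 hkm hb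
    · rw [mul_comm (t ^ q ^ a), ← key b a k hk1 hkm ha]
      refine Finset.sum_congr rfl fun i _ => ?_
      ring
  let W := mooreMatrix q w
  let U := mooreMatrix q u
  let φ := powHom hq Ω
  let S : Matrix (Fin m) (Fin m) Ω := Matrix.of fun i j => algebraMap F Ω (s i * s j ^ q)
  have hentry : ∀ x : Fin m → Ω, ∀ a i, (mooreMatrix q x).map φ a i = x i ^ q ^ (2 * (a : ℕ) + 1) := by
    intro x a i
    simp only [mooreMatrix, Matrix.map_apply, Matrix.of_apply, φ, powHom_apply, ← pow_mul,
      ← pow_succ]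
  have hentry2 : ∀ x : Fin m → Ω, ∀ a i, ((mooreMatrix q x).map φ).map φ a i =
      x i ^ q ^ (2 * (a : ℕ) + 2) := by
    intro x a i
    rw [Matrix.map_apply, hentry]
    simp only [φ, powHom_apply, ← pow_mul, ← pow_succ]
  have hWdet : IsUnit W.det := (det_mooreMatrix_ne_zero hq hw).isUnit
  have hφdet : ∀ N : Matrix (Fin m) (Fin m) Ω, IsUnit N.det → IsUnit (N.map φ).det := by
    intro N hN
    have : (N.map φ).det = φ N.det := (RingHom.map_det φ N).symm
    rw [this]
    exact hN.map φ
  have hW1 : IsUnit (W.map φ).det := hφdet _ hWdet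
  have hW2 : IsUnit ((W.map φ).map φ).det := hφdet _ hW1
  have rhs : ∀ (V : Matrix (Fin m) (Fin m) Ω) (a b : Fin m) (n : ℕ),
      (∀ i, V a i = w i ^ q ^ (2 * n)) →
      (V * S * (W.map φ).transpose) a b = t ^ q ^ (2 * n) * t ^ q ^ (2 * (b : ℕ) + 1) := by
    intro V a b n hV
    rw [hs', hs', Finset.sum_mul_sum, Matrix.mul_apply]
    simp only [Matrix.mul_apply, Finset.sum_mul]
    rw [Finset.sum_comm]
    refine Finset.sum_congr rfl fun i _ => Finset.sum_congr rfl fun j _ => ?_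
    rw [hV, Matrix.transpose_apply, hentry, pow_q_pow_even hq, pow_q_pow_odd hq]
    simp only [S, Matrix.of_apply, map_mul]
    ring
  have eq1 : W * (U.map φ).transpose + U * (W.map φ).transpose = W * S * (W.map φ).transpose := by
    ext a b
    rw [rhs W a b a (fun i => rfl), Matrix.add_apply, Matrix.mul_apply, Matrix.mul_apply,
      ← Finset.sum_add_distrib]
    simp only [Matrix.transpose_apply, U, W, hentry]
    rcases le_or_gt (a : ℕ) b with hab | hab
    · exact key2 (2 * a) (2 * b + 1) (b - a + 1) (by omega) (by omega) (by omega)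
    · exact key2 (2 * a) (2 * b + 1) (a - b) (by omega) (by omega) (by omega)
  have eq2 : (W.map φ).map φ * (U.map φ).transpose + (U.map φ).map φ * (W.map φ).transpose =
      (W.map φ).map φ * S * (W.map φ).transpose := by
    ext a b
    rw [rhs _ a b (a + 1) (fun i => hentry2 w a i), Matrix.add_apply, Matrix.mul_apply,
      Matrix.mul_apply, ← Finset.sum_add_distrib]
    simp only [Matrix.transpose_apply, U, W, hentry, hentry2]
    rcases lt_or_ge (a : ℕ) b with hab | hab
    · exact key2 (2 * a + 2) (2 * b + 1) (b - a) (by omega) (by omega) (by omega)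
    · exact key2 (2 * a + 2) (2 * b + 1) (a - b + 1) (by omega) (by omega) (by omega)
  let M := W⁻¹ * U
  have hUM : U = W * M := by rw [← Matrix.mul_assoc, Matrix.mul_nonsing_inv _ hWdet, Matrix.one_mul]
  have hUM2 : (U.map φ).map φ = (W.map φ).map φ * (M.map φ).map φ := by
    rw [hUM, Matrix.map_mul, Matrix.map_mul]
  -- Cancelling the invertible left factor from both equations.
  have e1 : (U.map φ).transpose + M * (W.map φ).transpose = S * (W.map φ).transpose := by
    have := congrArg (fun N => W⁻¹ * N) eq1
    simpa only [Matrix.mul_add, Matrix.mul_assoc, Matrix.nonsing_inv_mul_cancel_left _ _ hWdet, M]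
      using this
  have e2 : (U.map φ).transpose + (M.map φ).map φ * (W.map φ).transpose =
      S * (W.map φ).transpose := by
    rw [hUM2, Matrix.mul_assoc, Matrix.mul_assoc, ← Matrix.mul_add] at eq2
    have := congrArg (fun N => ((W.map φ).map φ)⁻¹ * N) eq2
    simpa only [Matrix.nonsing_inv_mul_cancel_left _ _ hW2] using this
  have e3 : (M.map φ).map φ = M := by
    have h3 := add_left_cancel (e2.trans e1.symm)
    have hu : IsUnit ((W.map φ).transpose).det := by rwa [Matrix.det_transpose]
    have := congrArg (fun N => N * ((W.map φ).transpose)⁻¹) h3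
    simpa only [Matrix.mul_nonsing_inv_cancel_right _ _ hu] using this
  have hM : ∀ i j, ∃ c : F, algebraMap F Ω c = M i j := by
    intro i j
    apply exists_algebraMap_eq_of_pow_eq hq
    have := congrFun (congrFun e3 i) j
    simp only [Matrix.map_apply, φ, powHom_apply, ← pow_mul, ← sq] at this
    exact this
  choose c hc using hM
  have hm : 0 < m := l.pos
  have hrow := congrFun (congrFun hUM ⟨0, hm⟩) l
  simp only [Matrix.mul_apply, U, W, mooreMatrix, Matrix.of_apply, mul_zero, pow_zero,
    pow_one] at hrow
  rw [hrow]
  refine Submodule.sum_mem _ fun j _ => ?_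
  rw [← hc, mul_comm, ← Algebra.smul_def]
  exact Submodule.smul_mem _ _ (Submodule.subset_span ⟨j, rfl⟩)

end Moore

/-! ### The product over a coset of a finite additive subgroup -/

section Coset

variable {Ω : Type*} [Field Ω]

/-- The polynomial `∏ (X + u)`, over a finite additive subgroup, takes the value `∏ (a + u)`
exactly on the coset of `a`, and only simply there. -/
theorem prod_X_add_C_addSubgroup (S : AddSubgroup Ω) [Fintype S] (a : Ω) :
    ∏ u : S, (Polynomial.X + Polynomial.C (u : Ω)) =
      Polynomial.C (∏ u : S, (a + u)) + ∏ u : S, (Polynomial.X - Polynomial.C (a + u)) := by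
  classical
  have hmon1 : (∏ u : S, (Polynomial.X + Polynomial.C (u : Ω))).Monic :=
    Polynomial.monic_prod_of_monic _ _ fun u _ => Polynomial.monic_X_add_C _
  have hmon2 : (∏ u : S, (Polynomial.X - Polynomial.C (a + (u : Ω)))).Monic :=
    Polynomial.monic_prod_of_monic _ _ fun u _ => Polynomial.monic_X_sub_C _
  have hd1 : (∏ u : S, (Polynomial.X + Polynomial.C (u : Ω))).degree =
      ((Fintype.card S : ℕ) : WithBot ℕ) := by
    simp [Polynomial.degree_prod]
  have hd2 : (∏ u : S, (Polynomial.X - Polynomial.C (a + (u : Ω)))).degree =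
      ((Fintype.card S : ℕ) : WithBot ℕ) := by
    simp only [Polynomial.degree_prod, Polynomial.degree_X_sub_C]; simp
  rw [← sub_eq_iff_eq_add, ← sub_eq_zero]
  have hpos : 0 < Fintype.card S := Fintype.card_pos
  have hlt := Polynomial.degree_sub_lt_left (hd1.trans hd2.symm) hmon1.ne_zero
    (hmon1.leadingCoeff.trans hmon2.leadingCoeff.symm)
  refine Polynomial.eq_zero_of_degree_lt_of_eval_index_eq_zero (s := Finset.univ)
    (v := fun u : S => a + (u : Ω)) ?_ ?_ ?_
  · intro u _ v _ huv
    exact Subtype.ext (add_left_cancel huv)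
  · refine (Polynomial.degree_sub_le _ _).trans_lt (max_lt ?_ ?_)
    · rw [hd1] at hlt; exact hlt
    · refine Polynomial.degree_C_le.trans_lt ?_
      simpa using hpos
  · intro v _
    simp only [Polynomial.eval_sub, Polynomial.eval_prod, Polynomial.eval_add, Polynomial.eval_X,
      Polynomial.eval_C]
    rw [Finset.prod_eq_zero (f := fun u : S => a + v - (a + u)) (Finset.mem_univ v) (sub_self _),
      sub_zero, sub_eq_zero]
    exact Fintype.prod_equiv (Equiv.addLeft v) _ _ fun u => by simp [add_assoc]

theorem sub_mem_of_prod_add_eq (S : AddSubgroup Ω) [Fintype S] {a b : Ω}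
    (h : ∏ u : S, (b + u) = ∏ u : S, (a + u)) : b - a ∈ S := by
  have := congrArg (Polynomial.eval b) (prod_X_add_C_addSubgroup S a)
  simp only [Polynomial.eval_prod, Polynomial.eval_add, Polynomial.eval_sub, Polynomial.eval_X,
    Polynomial.eval_C, h] at this
  obtain ⟨u, -, hu⟩ := Finset.prod_eq_zero_iff.1 (left_eq_add.1 this)
  have : b - a = u := by linear_combination hu
  rw [this]
  exact u.2

theorem sum_prod_erase_add_ne_zero (S : AddSubgroup Ω) [Fintype S] [DecidableEq S] (a : Ω) :
    ∑ u : S, ∏ v ∈ Finset.univ.erase u, (a + v) ≠ 0 := by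
  have h := congrArg (fun P => (Polynomial.derivative P).eval a) (prod_X_add_C_addSubgroup S a)
  simp only [Polynomial.derivative_prod_finset, Polynomial.derivative_add, Polynomial.derivative_X,
    Polynomial.derivative_C, Polynomial.derivative_sub, Polynomial.eval_finsetSum,
    Polynomial.eval_prod, Polynomial.eval_add, Polynomial.eval_sub,
    Polynomial.eval_X, Polynomial.eval_C, add_zero, sub_zero, zero_add, mul_one] at h
  rw [h, Finset.sum_eq_single 0]
  · refine Finset.prod_ne_zero_iff.2 fun v hv h0 => ?_
    have : (v : Ω) = 0 := by linear_combination -h0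
    exact (Finset.mem_erase.1 hv).1 (Subtype.ext this)
  · intro u _ hu
    exact Finset.prod_eq_zero (Finset.mem_erase.2 ⟨hu.symm, Finset.mem_univ _⟩) (by simp)
  · simp

/-- A derivation with values in a field of which `∏ (a + u)` is a constant, the product being over
a finite additive subgroup of constants, kills `a`, because `∏ (X + u)` is separable. -/
theorem derivation_eq_zero_of_prod_add {K : Type*} [Field K] [Algebra K Ω] (D : Derivation K Ω Ω)
    (S : AddSubgroup Ω) [Fintype S] (hS : ∀ u ∈ S, D u = 0) {a : Ω}
    (h : D (∏ u : S, (a + u)) = 0) : D a = 0 := by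
  classical
  have : ∀ s : Finset S, D (∏ u ∈ s, (a + u)) = (∑ u ∈ s, ∏ v ∈ s.erase u, (a + v)) * D a := by
    intro s
    induction s using Finset.induction_on with
    | empty => simp
    | insert x s hx ih =>
      rw [Finset.prod_insert hx, Derivation.leibniz, ih, map_add, hS x x.2, Finset.sum_insert hx,
        Finset.erase_insert hx]
      have : ∀ u ∈ s, ∏ v ∈ (insert x s).erase u, (a + (v : Ω)) =
          (a + x) * ∏ v ∈ s.erase u, (a + (v : Ω)) := by
        intro u hu
        rw [Finset.erase_insert_of_ne (by rintro rfl; exact hx hu), Finset.prod_insert]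
        simp [hx]
      rw [Finset.sum_congr rfl this, ← Finset.mul_sum]
      simp only [smul_eq_mul]
      ring
  rw [this] at h
  exact (mul_eq_zero.1 h).resolve_left (sum_prod_erase_add_ne_zero S a)

end Coset

/-! ### The unitary group and its action on the variables -/

section Unitary

variable {F : Type*} [Field F] {q : ℕ}

theorem exists_lowerUnitriangular_eq {n : ℕ} (N : Matrix (Fin n) (Fin n) F)
    (h1 : ∀ i, N i i = 1) (h0 : ∀ i j, i < j → N i j = 0) :
    ∃ g ∈ lowerUnitriangular F n, g.1 = N := by
  have hdet : N.det = 1 := by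
    rw [Matrix.det_of_isLowerTriangular N (fun i j h => h0 i j h)]
    simp [h1]
  exact ⟨Matrix.GeneralLinearGroup.mkOfDetNeZero N (by rw [hdet]; exact one_ne_zero),
    ⟨h1, h0⟩, rfl⟩

theorem polyAction_X {n : ℕ} (g : GL (Fin n) F) (i : Fin n) :
    polyAction F n g (MvPolynomial.X i) =
      ∑ j, MvPolynomial.C ((g⁻¹).1 i j) * MvPolynomial.X j := by
  change linSubst (g⁻¹).1 (MvPolynomial.X i) = _
  simp [linSubst]

variable [Fintype F]

theorem mem_generalUnitaryGroup_iff (hq : Fintype.card F = q ^ 2) {n : ℕ} (N : GL (Fin n) F) :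
    N ∈ generalUnitaryGroup hq n ↔
      ∀ a b, ∑ k, N.1 k a * N.1 k.rev b ^ q = if b = a.rev then 1 else 0 := by
  have h : ∀ a b, (N.1.transpose * antidiagMatrix F n * N.1.map (conjHom hq)) a b =
      ∑ k, N.1 k a * N.1 k.rev b ^ q := by
    intro a b
    rw [Matrix.mul_assoc, Matrix.mul_apply]
    refine Finset.sum_congr rfl fun k _ => ?_
    rw [Matrix.transpose_apply, Matrix.mul_apply, Finset.sum_eq_single k.rev]
    · simp [antidiagMatrix, conjHom]
    · intro l _ hl
      simp [antidiagMatrix, hl]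
    · simp
  constructor
  · intro hN a b
    rw [← h, show N.1.transpose * antidiagMatrix F n * N.1.map (conjHom hq) =
      antidiagMatrix F n from hN]
    rfl
  · intro hN
    change N.1.transpose * antidiagMatrix F n * N.1.map (conjHom hq) = antidiagMatrix F n
    ext a b
    rw [h, hN]
    rfl

/-- Each of the first `m + 1` rows of an element of the Sylow subgroup can be prescribed freely
left of the diagonal. -/
theorem exists_mem_unitarySylow_row (hq : Fintype.card F = q ^ 2) {m : ℕ} (j : Fin (2 * m + 1))
    (hj : (j : ℕ) ≤ m) (r : Fin (2 * m + 1) → F) (hr : ∀ i, j ≤ i → r i = 0) :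
    ∃ g ∈ unitarySylow hq m, ∀ i, g.1 j i = (if i = j then 1 else 0) + r i := by
  have hq0 : q ≠ 0 := by have := one_lt_of_card_eq_sq hq; omega
  have hqq : ∀ c : F, (c ^ q) ^ q = c := fun c => by
    rw [← pow_mul, ← sq, ← hq, FiniteField.pow_card]
  -- The constant `t` compensates for `⟨e_j, e_j⟩`, which is `1` for the middle index and `0` else.
  obtain ⟨t, ht⟩ : ∃ t : F, t + t ^ q = if j.rev = j then 1 else 0 := by
    split_ifs
    · exact exists_add_pow_eq_one hq
    · exact ⟨0, by simp [hq0]⟩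
  have hrev : ∀ i, r i ≠ 0 → r i.rev = 0 := by
    intro i hi
    apply hr
    have : i < j := by
      by_contra h
      exact hi (hr i (not_lt.1 h))
    rw [Fin.le_def, Fin.val_rev]
    rw [Fin.lt_def] at this
    omega
  have hjr : r j.rev = 0 := by
    apply hr
    rw [Fin.le_def, Fin.val_rev]
    omega
  -- The map `v ↦ v + (r ⬝ v) e_j - (v_{j'} + t (r ⬝ v)) J r̄`.
  let N : Matrix (Fin (2 * m + 1)) (Fin (2 * m + 1)) F := Matrix.of fun k i =>
    (if k = i then 1 else 0) + (if k = j then r i else 0) -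
      r k.rev ^ q * ((if i = j.rev then 1 else 0) + t * r i)
  obtain ⟨g, hg, hgN⟩ := exists_lowerUnitriangular_eq N
    (by
      intro k
      have e1 : (if k = j then r k else 0) = 0 := by
        split_ifs with h
        · exact hr k h.ge
        · rfl
      have e2 : r k.rev ^ q * ((if k = j.rev then 1 else 0) + t * r k) = 0 := by
        split_ifs with h
        · rw [h, Fin.rev_rev, hr j le_rfl, zero_pow hq0, zero_mul]
        · by_cases hk : r k = 0
          · rw [hk]; ring
          · rw [hrev k hk, zero_pow hq0, zero_mul]
      simp [N, e1, e2])
    (by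
      intro k i hki
      have e1 : (if k = j then r i else 0) = 0 := by
        split_ifs with h
        · exact hr i (h ▸ hki.le)
        · rfl
      have e2 : r k.rev ^ q * ((if i = j.rev then 1 else 0) + t * r i) = 0 := by
        by_cases hk : r k.rev = 0
        · rw [hk, zero_pow hq0, zero_mul]
        · have h1 : k.rev < j := by
            by_contra h
            exact hk (hr _ (not_lt.1 h))
          rw [Fin.lt_def] at hki h1
          rw [Fin.val_rev] at h1
          rw [hr i (Fin.le_def.2 (by omega)), if_neg]
          · ring
          · rintro rfl
            rw [Fin.val_rev] at hki
            omega
      simp [N, hki.ne, e1, e2])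
  refine ⟨g, ⟨hg, ?_⟩, ?_⟩
  · change g ∈ generalUnitaryGroup hq (2 * m + 1)
    rw [mem_generalUnitaryGroup_iff, hgN]
    intro a b
    have hN' : ∀ k, N k.rev b ^ q = (if k.rev = b then 1 else 0) +
        (if k.rev = j then r b ^ q else 0) - r k * ((if b = j.rev then 1 else 0) + t ^ q * r b ^ q) := by
      intro k
      have hpow : ∀ (p : Prop) [Decidable p] (c : F), (if p then c else 0) ^ q =
          if p then c ^ q else 0 := by
        intro p _ c
        split_ifs <;> simp [hq0]
      have hsub : ∀ x y : F, (x - y) ^ q = x ^ q - y ^ q := fun x y => by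
        simpa using sub_pow_q_pow hq x y 1
      simp only [N, Matrix.of_apply, hsub, add_pow_of_card_eq_sq hq, mul_pow, hpow, one_pow, hqq,
        Fin.rev_rev]
    have hsum : ∑ k, r k.rev ^ q * r k = 0 := by
      refine Finset.sum_eq_zero fun k _ => ?_
      by_cases hk : r k = 0
      · rw [hk, mul_zero]
      · rw [hrev k hk, zero_pow hq0, zero_mul]
    have hb : ∑ k : Fin (2 * m + 1), r k.rev ^ q * (if k.rev = b then 1 else 0) = r b ^ q := by
      rw [Finset.sum_eq_single b.rev]
      · simp
      · intro k _ hk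
        rw [if_neg, mul_zero]
        rintro rfl
        simp at hk
      · simp
    have hbj : ∑ k : Fin (2 * m + 1), r k.rev ^ q * (if k.rev = j then r b ^ q else 0) = 0 := by
      refine Finset.sum_eq_zero fun k _ => ?_
      split_ifs with h
      · rw [h, hr j le_rfl, zero_pow hq0, zero_mul]
      · rw [mul_zero]
    have hthird : ∑ k : Fin (2 * m + 1), r k.rev ^ q * ((if a = j.rev then 1 else 0) + t * r a) *
        N k.rev b ^ q = ((if a = j.rev then 1 else 0) + t * r a) * r b ^ q := by
      have : ∀ k : Fin (2 * m + 1), r k.rev ^ q * ((if a = j.rev then 1 else 0) + t * r a) *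
          N k.rev b ^ q = ((if a = j.rev then 1 else 0) + t * r a) *
          (r k.rev ^ q * (if k.rev = b then 1 else 0) +
            r k.rev ^ q * (if k.rev = j then r b ^ q else 0) -
            ((if b = j.rev then 1 else 0) + t ^ q * r b ^ q) * (r k.rev ^ q * r k)) := by
        intro k
        rw [hN']
        ring
      simp only [this]
      rw [← Finset.mul_sum, Finset.sum_sub_distrib, Finset.sum_add_distrib, ← Finset.mul_sum, hsum,
        hb, hbj]
      ring
    have hfirst : ∀ k, N k a * N k.rev b ^ q = (if k = a then N k.rev b ^ q else 0) +
        (if k = j then r a * N k.rev b ^ q else 0) -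
        r k.rev ^ q * ((if a = j.rev then 1 else 0) + t * r a) * N k.rev b ^ q := by
      intro k
      have : N k a = (if k = a then 1 else 0) + (if k = j then r a else 0) -
        r k.rev ^ q * ((if a = j.rev then 1 else 0) + t * r a) := rfl
      rw [this]
      split_ifs <;> ring
    simp only [hfirst]
    rw [Finset.sum_sub_distrib, Finset.sum_add_distrib, hthird, Finset.sum_ite_eq' Finset.univ a,
      Finset.sum_ite_eq' Finset.univ j, if_pos (Finset.mem_univ _), if_pos (Finset.mem_univ _),
      hN', hN', hr j le_rfl]
    have e1 : (if a.rev = j then r b ^ q else 0) = (if a = j.rev then 1 else 0) * r b ^ q := by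
      simp [Fin.rev_eq_iff]
    have e2 : (if j.rev = b then (1 : F) else 0) = if b = j.rev then 1 else 0 := by
      simp only [eq_comm]
    have e3 : (if j.rev = j then r b ^ q else 0) = (t + t ^ q) * r b ^ q := by
      rw [ht, ite_mul, one_mul, zero_mul]
    have e4 : (if a.rev = b then (1 : F) else 0) = if b = a.rev then 1 else 0 := by
      simp only [eq_comm]
    rw [e1, e2, e3, e4]
    ring
  · intro i
    rw [hgN]
    simp only [N, Matrix.of_apply, if_true, hjr, zero_pow hq0, zero_mul, sub_zero]
    simp only [eq_comm]

/-- The orbit of `x_j`, for `j` at most the middle index, consists of all `x_j + ∑ c_i x_i` with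
`i < j`. -/
theorem range_polyAction_X (hq : Fintype.card F = q ^ 2) {m : ℕ} (j : Fin (2 * m + 1))
    (hj : (j : ℕ) ≤ m) :
    Set.range (fun g : unitarySylow hq m => polyAction F (2 * m + 1) g (MvPolynomial.X j)) =
      Set.range (fun c : {i // i < j} → F =>
        (MvPolynomial.X j + ∑ i, c i • MvPolynomial.X (i : Fin (2 * m + 1)) :
          MvPolynomial (Fin (2 * m + 1)) F)) := by
  have hrow : ∀ c : Fin (2 * m + 1) → F, c j = 1 → (∀ i, j < i → c i = 0) →
      ∑ i, MvPolynomial.C (c i) * MvPolynomial.X i = (MvPolynomial.X j +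
        ∑ i : {i // i < j}, c i • MvPolynomial.X (i : Fin (2 * m + 1)) :
          MvPolynomial (Fin (2 * m + 1)) F) := by
    intro c h1 h0
    rw [Fintype.sum_eq_add_sum_compl j, h1, MvPolynomial.C_1, one_mul]
    congr 1
    simp only [MvPolynomial.smul_eq_C_mul]
    rw [← Finset.sum_subtype (Finset.univ.filter (· < j)) (by simp)
      (fun i => (MvPolynomial.C (c i) * MvPolynomial.X i : MvPolynomial (Fin (2 * m + 1)) F))]
    symm
    refine Finset.sum_subset (fun i hi => ?_) fun i hi hij => ?_
    · simpa using (Finset.mem_filter.1 hi).2.ne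
    · rw [h0 i, MvPolynomial.C_0, zero_mul]
      simp only [Finset.mem_filter, Finset.mem_univ, true_and, not_lt, Finset.mem_compl,
        Finset.mem_singleton] at hi hij
      exact lt_of_le_of_ne hij (Ne.symm hi)
  ext f
  constructor
  · rintro ⟨⟨g, hg⟩, rfl⟩
    have hg' := (unitarySylow hq m).inv_mem hg
    refine ⟨fun i => (g⁻¹).1 j i, ?_⟩
    simp only [polyAction_X]
    exact (hrow (fun i => (g⁻¹).1 j i) (hg'.1.1 j) (fun i hi => hg'.1.2 j i hi)).symm
  · rintro ⟨c, rfl⟩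
    obtain ⟨g, hg, hgj⟩ := exists_mem_unitarySylow_row hq j hj
      (fun i => if h : i < j then c ⟨i, h⟩ else 0) (fun i hi => by simp [not_lt.2 hi])
    refine ⟨⟨g⁻¹, (unitarySylow hq m).inv_mem hg⟩, ?_⟩
    simp only [polyAction_X, inv_inv]
    rw [hrow (fun i => g.1 j i)]
    · congr 1
      refine Finset.sum_congr rfl fun i _ => ?_
      simp only [hgj]
      rw [if_neg i.2.ne, zero_add, dif_pos i.2]
    · simp [hgj]
    · intro i hi
      simp [hgj, hi.ne', not_lt.2 hi.le]

/-- An injective homomorphism maps the orbit product of `x_j` to the product of the coset of the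
image of `x_j` modulo the span of the images of the `x_i` with `i < j`. -/
theorem map_orbitProduct_X (hq : Fintype.card F = q ^ 2) {m : ℕ} (j : Fin (2 * m + 1))
    (hj : (j : ℕ) ≤ m) {Ω : Type*} [Field Ω] [Algebra F Ω]
    (f : MvPolynomial (Fin (2 * m + 1)) F →ₐ[F] Ω) (hf : Function.Injective f)
    (S : AddSubgroup Ω) [Fintype S]
    (hS : S = (Submodule.span F ((fun i => f (MvPolynomial.X i)) '' Set.Iio j)).toAddSubgroup) :
    f (orbitProduct (unitarySylow hq m) (MvPolynomial.X j)) =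
      ∏ u : S, (f (MvPolynomial.X j) + u) := by
  have hX : LinearIndependent F
      (fun i : {i // i < j} => (MvPolynomial.X (i : Fin (2 * m + 1)) :
        MvPolynomial (Fin (2 * m + 1)) F)) :=
    (MvPolynomial.linearIndependent_X (Fin (2 * m + 1)) F).comp _ Subtype.val_injective
  have hinj : Function.Injective (fun c : {i // i < j} → F =>
      ∑ i, c i • (MvPolynomial.X (i : Fin (2 * m + 1)) : MvPolynomial (Fin (2 * m + 1)) F)) :=
    linearIndependent_iff_injective_fintypeLinearCombination.1 hX
  rw [orbitProduct, range_polyAction_X hq j hj, finprod_mem_range, finprod_eq_prod_of_fintype,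
    map_prod]
  · have hmem : ∀ c : {i // i < j} → F, ∑ i, c i • f (MvPolynomial.X (i : Fin (2 * m + 1))) ∈ S := by
      intro c
      rw [hS]
      exact Submodule.sum_mem _ fun i _ =>
        Submodule.smul_mem _ _ (Submodule.subset_span ⟨i, i.2, rfl⟩)
    refine Fintype.prod_bijective (fun c => ⟨_, hmem c⟩) ⟨?_, ?_⟩ _ _ fun c => ?_
    · intro c d hcd
      apply hinj
      apply hf
      simpa using hcd
    · rintro ⟨u, hu⟩
      have himage : (fun i => f (MvPolynomial.X i)) '' Set.Iio j =
          Set.range (fun i : {i // i < j} => f (MvPolynomial.X (i : Fin (2 * m + 1)))) :=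
        Set.image_eq_range _ _
      have hu' := hu
      rw [hS, Submodule.mem_toAddSubgroup, himage,
        Submodule.mem_span_range_iff_exists_fun] at hu'
      obtain ⟨c, hc⟩ := hu'
      exact ⟨c, Subtype.ext hc⟩
    · simp
  · intro c d hcd
    exact hinj (add_left_cancel hcd)

end Unitary

/-! ### The Hermitian forms `h_k` -/

section Hermitian

variable {F : Type*} [Field F] {q : ℕ}

/-- The index `l < m` as an index below `2 * m + 1`. -/
def lowIndex {m : ℕ} (l : Fin m) : Fin (2 * m + 1) := ⟨l, by omega⟩

/-- The middle index of `Fin (2 * m + 1)`. -/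
def midIndex (m : ℕ) : Fin (2 * m + 1) := ⟨m, by omega⟩

theorem sum_eq_sum_lowIndex {m : ℕ} {A : Type*} [AddCommMonoid A] (f : Fin (2 * m + 1) → A) :
    ∑ i ∈ Finset.univ.filter (fun i : Fin (2 * m + 1) => (i : ℕ) < m), f i =
      ∑ l, f (lowIndex l) := by
  symm
  refine Finset.sum_bij (fun l _ => lowIndex l) ?_ ?_ ?_ ?_
  · intro l _
    simp [lowIndex]
  · intro a _ b _ h
    exact Fin.ext (Fin.ext_iff.1 h :)
  · intro i hi
    exact ⟨⟨i, (Finset.mem_filter.1 hi).2⟩, Finset.mem_univ _, rfl⟩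
  · intros
    rfl

theorem sum_eq_sum_lowIndex_add_rev {m : ℕ} {A : Type*} [AddCommMonoid A]
    (f : Fin (2 * m + 1) → A) :
    ∑ i, f i = ∑ l, (f (lowIndex l) + f (lowIndex l).rev) + f (midIndex m) := by
  rw [← Finset.sum_filter_add_sum_filter_not Finset.univ
    (fun i : Fin (2 * m + 1) => (i : ℕ) < m), sum_eq_sum_lowIndex, Finset.sum_add_distrib, add_assoc]
  congr 1
  have h : Finset.univ.filter (fun i : Fin (2 * m + 1) => ¬ (i : ℕ) < m) =
      insert (midIndex m) (Finset.univ.image fun l : Fin m => (lowIndex l).rev) := by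
    ext i
    simp only [Finset.mem_filter, Finset.mem_univ, true_and, Finset.mem_insert, Finset.mem_image,
      midIndex, lowIndex, Fin.ext_iff, Fin.val_rev]
    constructor
    · intro hi
      by_cases him : (i : ℕ) = m
      · exact Or.inl him
      · exact Or.inr ⟨⟨2 * m - i, by omega⟩, by simp only; omega⟩
    · rintro (hi | ⟨l, hl⟩) <;> omega
  rw [h, Finset.sum_insert, Finset.sum_image, add_comm]
  · intro a _ b _ hab
    exact Fin.ext (Fin.ext_iff.1 (Fin.rev_injective hab) :)
  · simp only [Finset.mem_image, Finset.mem_univ, true_and, not_exists, midIndex, lowIndex,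
      Fin.ext_iff, Fin.val_rev]
    intro l
    omega

theorem map_hPoly {m k : ℕ} {A : Type*} [CommRing A] [Algebra F A]
    (f : MvPolynomial (Fin (2 * m + 1)) F →ₐ[F] A) :
    f (hPoly F q m k) =
      ∑ l, (f (MvPolynomial.X (lowIndex l)) *
          f (MvPolynomial.X (lowIndex l).rev) ^ q ^ (2 * k - 1) +
        f (MvPolynomial.X (lowIndex l).rev) *
          f (MvPolynomial.X (lowIndex l)) ^ q ^ (2 * k - 1)) +
      f (MvPolynomial.X (midIndex m)) * f (MvPolynomial.X (midIndex m)) ^ q ^ (2 * k - 1) := by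
  rw [hPoly, lambdaPoly, sum_eq_sum_lowIndex]
  simp only [map_add, map_mul, map_sum, map_pow, map_one, one_mul, midIndex]
  congr 1
  · exact Finset.sum_congr rfl fun l _ => by ring
  · ring

theorem map_hPoly_eq_sum {m k : ℕ} {A : Type*} [CommRing A] [Algebra F A]
    (f : MvPolynomial (Fin (2 * m + 1)) F →ₐ[F] A) :
    f (hPoly F q m k) =
      ∑ i, f (MvPolynomial.X i) * f (MvPolynomial.X i.rev) ^ q ^ (2 * k - 1) := by
  rw [map_hPoly, sum_eq_sum_lowIndex_add_rev]
  have : (midIndex m).rev = midIndex m := by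
    simp only [midIndex, Fin.ext_iff, Fin.val_rev]
    omega
  simp only [Fin.rev_rev, this]

variable [Fintype F]

/-- The effect of a linear substitution on the form `∑ x_i * x_{i'} ^ (q ^ (2 * k - 1))`. -/
theorem sum_mul_rev_pow_substitution (hq : Fintype.card F = q ^ 2) {n k : ℕ} (hk : 1 ≤ k)
    {A : Type*} [CommRing A] [Algebra F A] (N : Matrix (Fin n) (Fin n) F) (x : Fin n → A) :
    ∑ i : Fin n, (∑ a, N i a • x a) * (∑ b, N i.rev b • x b) ^ q ^ (2 * k - 1) =
      ∑ a, ∑ b, (∑ i : Fin n, N i a * N i.rev b ^ q) • (x a * x b ^ q ^ (2 * k - 1)) := by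
  obtain ⟨k, rfl⟩ : ∃ l, k = l + 1 := ⟨k - 1, by omega⟩
  have he : 2 * (k + 1) - 1 = 2 * k + 1 := by omega
  rw [he]
  simp only [sum_pow_q_pow hq, smul_pow, pow_q_pow_odd hq, Finset.sum_mul_sum, Finset.sum_smul,
    smul_mul_smul_comm]
  rw [Finset.sum_comm]
  exact Finset.sum_congr rfl fun a _ => Finset.sum_comm

theorem polyAction_hPoly (hq : Fintype.card F = q ^ 2) {m k : ℕ} (hk : 1 ≤ k)
    {g : GL (Fin (2 * m + 1)) F} (hg : g ∈ generalUnitaryGroup hq (2 * m + 1)) :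
    polyAction F (2 * m + 1) g (hPoly F q m k) = hPoly F q m k := by
  have hg' := (mem_generalUnitaryGroup_iff hq _).1 ((generalUnitaryGroup hq _).inv_mem hg)
  have h1 := map_hPoly_eq_sum (q := q) (k := k) (polyAction F (2 * m + 1) g).toAlgHom
  have h2 := map_hPoly_eq_sum (q := q) (k := k) (AlgHom.id F (MvPolynomial (Fin (2 * m + 1)) F))
  change polyAction F (2 * m + 1) g (hPoly F q m k) = ∑ i, polyAction F (2 * m + 1) g _ *
    polyAction F (2 * m + 1) g _ ^ _ at h1
  simp only [polyAction_X, AlgHom.id_apply, ← MvPolynomial.smul_eq_C_mul] at h1 h2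
  rw [h1, sum_mul_rev_pow_substitution hq hk, h2]
  simp only [hg', ite_smul, one_smul, zero_smul, Finset.sum_ite_eq', Finset.mem_univ, if_true]

/-- The form `∑ x_i * x_{i'} ^ q` in algebraically independent elements determines the
matrix of the Hermitian form. -/
theorem mem_generalUnitaryGroup_of_map_hPoly_eq (hq : Fintype.card F = q ^ 2) {m : ℕ}
    {Ω : Type*} [Field Ω] [Algebra F Ω]
    {f g : MvPolynomial (Fin (2 * m + 1)) F →ₐ[F] Ω} (hf : Function.Injective f)
    (h : f (hPoly F q m 1) = g (hPoly F q m 1)) (N : GL (Fin (2 * m + 1)) F)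
    (hN : ∀ i, g (MvPolynomial.X i) = ∑ a, N.1 i a • f (MvPolynomial.X a)) :
    N ∈ generalUnitaryGroup hq (2 * m + 1) := by
  classical
  have hq1 := one_lt_of_card_eq_sq hq
  rw [mem_generalUnitaryGroup_iff]
  rw [map_hPoly_eq_sum, map_hPoly_eq_sum] at h
  simp only [hN] at h
  rw [sum_mul_rev_pow_substitution hq le_rfl] at h
  have h' : ∑ a : Fin (2 * m + 1), MvPolynomial.X a * MvPolynomial.X a.rev ^ q =
      ∑ a, ∑ b, (∑ i : Fin (2 * m + 1), N.1 i a * N.1 i.rev b ^ q) •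
        (MvPolynomial.X a * MvPolynomial.X b ^ q : MvPolynomial (Fin (2 * m + 1)) F) := by
    apply hf
    simpa using h
  have hmon : ∀ a b : Fin (2 * m + 1), (MvPolynomial.X a * MvPolynomial.X b ^ q :
      MvPolynomial (Fin (2 * m + 1)) F) =
      MvPolynomial.monomial (Finsupp.single a 1 + Finsupp.single b q) 1 := by
    intro a b
    rw [MvPolynomial.X_pow_eq_monomial, MvPolynomial.X, MvPolynomial.monomial_mul, one_mul]
  have hexp : ∀ a b a' b' : Fin (2 * m + 1),
      (Finsupp.single a 1 + Finsupp.single b q : Fin (2 * m + 1) →₀ ℕ) =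
        Finsupp.single a' 1 + Finsupp.single b' q ↔ a = a' ∧ b = b' := by
    intro a b a' b'
    constructor
    · intro hab
      have hb : b = b' := by
        by_contra hne
        have := DFunLike.congr_fun hab b
        simp only [Finsupp.add_apply, Finsupp.single_apply, if_true, if_neg (Ne.symm hne)] at this
        split_ifs at this <;> omega
      subst hb
      exact ⟨Finsupp.single_left_injective one_ne_zero (add_right_cancel hab), rfl⟩
    · rintro ⟨rfl, rfl⟩
      rfl
  intro a b
  have hc := congrArg (MvPolynomial.coeff (Finsupp.single a 1 + Finsupp.single b q)) h'
  simp only [hmon, MvPolynomial.coeff_sum, MvPolynomial.coeff_smul, MvPolynomial.coeff_monomial,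
    hexp, smul_eq_mul, mul_ite, mul_one, mul_zero] at hc
  simp only [ite_and, Finset.sum_ite_eq', Finset.mem_univ, if_true] at hc
  rw [Finset.sum_eq_single a, Finset.sum_eq_single b] at hc
  · simp only [if_true] at hc
    rw [← hc]
    simp only [eq_comm]
  · intro c _ hcb
    simp [hcb]
  · simp
  · intro c _ hca
    simp [hca]
  · simp

end Hermitian

/-! ### Homomorphisms that agree on the generators -/

section Triangular

variable {F : Type*} [Field F] {Ω : Type*} [AddCommGroup Ω] [Module F Ω] {n : ℕ}

theorem span_image_Iio_eq_of_sub_mem {w x : Fin n → Ω} (j : Fin n)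
    (h : ∀ i < j, w i - x i ∈ Submodule.span F (x '' Set.Iio i)) :
    Submodule.span F (w '' Set.Iio j) = Submodule.span F (x '' Set.Iio j) := by
  induction j using WellFoundedLT.induction with
  | _ j ih =>
  have hmono : ∀ (y : Fin n → Ω) (i : Fin n), i < j →
      Submodule.span F (y '' Set.Iio i) ≤ Submodule.span F (y '' Set.Iio j) :=
    fun y i hi => Submodule.span_mono (Set.image_mono (Set.Iio_subset_Iio hi.le))
  apply le_antisymm
  · rw [Submodule.span_le]
    rintro _ ⟨i, hi, rfl⟩
    have := Submodule.add_mem _ (hmono x i hi (h i hi)) (Submodule.subset_span ⟨i, hi, rfl⟩)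
    simpa using this
  · rw [Submodule.span_le]
    rintro _ ⟨i, hi, rfl⟩
    have h1 := h i hi
    rw [← ih i hi fun k hk => h k (hk.trans hi)] at h1
    have := Submodule.sub_mem _ (Submodule.subset_span (Set.mem_image_of_mem w hi))
      (hmono w i hi h1)
    simpa using this

theorem exists_sum_smul_of_mem_span_Iio {x : Fin n → Ω} {j : Fin n} {z : Ω}
    (hz : z ∈ Submodule.span F (x '' Set.Iio j)) :
    ∃ c : Fin n → F, (∀ i, j ≤ i → c i = 0) ∧ z = ∑ i, c i • x i := by
  classical
  obtain ⟨l, hl, rfl⟩ := (Finsupp.mem_span_image_iff_linearCombination F).1 hz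
  refine ⟨l, fun i hi => ?_, ?_⟩
  · by_contra h
    exact absurd (Finsupp.mem_supported F l |>.1 hl (Finsupp.mem_support_iff.2 h)) (not_lt.2 hi)
  · rw [Finsupp.linearCombination_apply, Finsupp.sum_fintype _ _ (by simp)]

theorem sum_smul_eq_sum_lowIndex {m : ℕ} {V : Type*} [AddCommGroup V] [Module F V]
    (x : Fin (2 * m + 1) → V) {c : Fin (2 * m + 1) → F} (hc : ∀ i, midIndex m ≤ i → c i = 0) :
    ∑ i, c i • x i = ∑ l, c (lowIndex l) • x (lowIndex l) := by
  rw [sum_eq_sum_lowIndex_add_rev, hc _ le_rfl, zero_smul, add_zero]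
  refine Finset.sum_congr rfl fun l _ => ?_
  rw [hc (lowIndex l).rev, zero_smul, add_zero]
  simp only [midIndex, lowIndex, Fin.le_def, Fin.val_rev]
  omega

end Triangular

section Agreement

variable {F : Type*} [Field F] [Fintype F] {q : ℕ} {m : ℕ} {Ω : Type*} [Field Ω] [Algebra F Ω]
  {f g : MvPolynomial (Fin (2 * m + 1)) F →ₐ[F] Ω}

theorem sub_mem_span_of_map_orbitProduct_eq (hq : Fintype.card F = q ^ 2)
    (hf : Function.Injective f) (hg : Function.Injective g)
    (h0 : f (MvPolynomial.X 0) = g (MvPolynomial.X 0))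
    (hN : ∀ j : Fin (2 * m + 1), 1 ≤ (j : ℕ) → (j : ℕ) ≤ m →
      f (orbitProduct (unitarySylow hq m) (MvPolynomial.X j)) =
        g (orbitProduct (unitarySylow hq m) (MvPolynomial.X j)))
    (j : Fin (2 * m + 1)) (hj : (j : ℕ) ≤ m) :
    g (MvPolynomial.X j) - f (MvPolynomial.X j) ∈
      Submodule.span F ((fun i => f (MvPolynomial.X i)) '' Set.Iio j) := by
  induction j using WellFoundedLT.induction with
  | _ j ih =>
  rcases Nat.eq_zero_or_pos (j : ℕ) with hj0 | hj0
  · have : j = 0 := Fin.ext hj0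
    rw [this, h0, sub_self]
    exact Submodule.zero_mem _
  · have hspan := span_image_Iio_eq_of_sub_mem (F := F) (w := fun i => g (MvPolynomial.X i))
      (x := fun i => f (MvPolynomial.X i)) j
      fun i hi => ih i hi ((Fin.lt_def.1 hi).le.trans hj)
    let T := Submodule.span F ((fun i => f (MvPolynomial.X i)) '' Set.Iio j)
    have : FiniteDimensional F T :=
      FiniteDimensional.span_of_finite F (Set.toFinite _)
    have : Finite T := Module.finite_of_finite F
    have : Fintype T.toAddSubgroup := @Fintype.ofFinite _ this
    apply sub_mem_of_prod_add_eq T.toAddSubgroup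
    rw [← map_orbitProduct_X hq j hj f hf T.toAddSubgroup rfl,
      ← map_orbitProduct_X hq j hj g hg T.toAddSubgroup (by rw [hspan]), hN j hj0 hj]

/-- The variables above the middle one: expressed in the images `w` under `g`, the equations for
the `h_k` become a system of the form treated in `mem_span_of_hermitian_system`. -/
theorem rev_sub_mem_span_of_map_hPoly_eq (hq : Fintype.card F = q ^ 2)
    (hg : Function.Injective g)
    (hlow : ∀ j : Fin (2 * m + 1), (j : ℕ) ≤ m → g (MvPolynomial.X j) - f (MvPolynomial.X j) ∈
      Submodule.span F ((fun i => f (MvPolynomial.X i)) '' Set.Iio j))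
    (hh : ∀ k, 1 ≤ k → k ≤ m → f (hPoly F q m k) = g (hPoly F q m k)) (l : Fin m) :
    g (MvPolynomial.X (lowIndex l).rev) - f (MvPolynomial.X (lowIndex l).rev) ∈
      Submodule.span F ((fun i => f (MvPolynomial.X i)) '' Set.Iio (lowIndex l).rev) := by
  let x : Fin (2 * m + 1) → Ω := fun i => f (MvPolynomial.X i)
  let w : Fin (2 * m + 1) → Ω := fun i => g (MvPolynomial.X i)
  have hspan : ∀ j : Fin (2 * m + 1), (j : ℕ) ≤ m →
      Submodule.span F (w '' Set.Iio j) = Submodule.span F (x '' Set.Iio j) := fun j hj =>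
    span_image_Iio_eq_of_sub_mem j fun i hi => hlow i ((Fin.lt_def.1 hi).le.trans hj)
  have hmid : ((midIndex m : Fin (2 * m + 1)) : ℕ) ≤ m := le_rfl
  have hlowlt : ∀ i : Fin m, lowIndex i < midIndex m := fun i => Fin.lt_def.2 i.2
  -- The variables `x_i`, `i ≤ m`, in terms of the `w_i`.
  have hexp : ∀ j : Fin (2 * m + 1), (j : ℕ) ≤ m → ∃ c : Fin (2 * m + 1) → F,
      (∀ i, j ≤ i → c i = 0) ∧ x j = w j + ∑ i : Fin m, c (lowIndex i) • w (lowIndex i) := by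
    intro j hj
    have h1 := Submodule.neg_mem _ (hlow j hj)
    rw [neg_sub, ← hspan j hj] at h1
    obtain ⟨c, hc, hc'⟩ := exists_sum_smul_of_mem_span_Iio h1
    refine ⟨c, hc, ?_⟩
    rw [← sum_smul_eq_sum_lowIndex w fun i hi => hc i ((Fin.le_def.2 hj).trans hi), ← hc']
    simp [x, w]
  choose c hc hxc using fun i : Fin m => hexp (lowIndex i) i.2.le
  obtain ⟨s, -, hxs⟩ := hexp (midIndex m) hmid
  let v : Fin m → Ω := fun i => w (lowIndex i)
  let y : Fin m → Ω := fun i => x (lowIndex i).rev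
  let z : Fin m → Ω := fun i => w (lowIndex i).rev
  let t : Ω := ∑ i, s (lowIndex i) • v i
  let B : Fin m → Fin m → F := fun i i' => (if i = i' then 1 else 0) + c i (lowIndex i')
  have hxB : ∀ i, x (lowIndex i) = ∑ i', B i i' • v i' := by
    intro i
    simp only [B, add_smul, Finset.sum_add_distrib, ite_smul, one_smul, zero_smul,
      Finset.sum_ite_eq, Finset.mem_univ, if_true]
    exact hxc i
  have hxt : x (midIndex m) = w (midIndex m) + t := hxs
  have hv : LinearIndependent F v := by
    have h1 := (MvPolynomial.linearIndependent_X (Fin (2 * m + 1)) F).map' g.toLinearMap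
      (LinearMap.ker_eq_bot.2 hg)
    exact h1.comp lowIndex fun a b h => Fin.ext (Fin.ext_iff.1 h :)
  let u : Fin m → Ω := fun i =>
    z i - ∑ i', B i' i ^ q • y i' - s (lowIndex i) ^ q • w (midIndex m)
  have hu : ∀ i, u i ∈ Submodule.span F (Set.range v) := by
    apply mem_span_of_hermitian_system hq hv (t := t)
    · exact Submodule.sum_mem _ fun i _ => Submodule.smul_mem _ _ (Submodule.subset_span ⟨i, rfl⟩)
    · intro k hk hkm
      have h1 := hh k hk hkm
      rw [map_hPoly, map_hPoly] at h1
      change ∑ i, (x (lowIndex i) * y i ^ q ^ (2 * k - 1) + y i * x (lowIndex i) ^ q ^ (2 * k - 1)) +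
        x (midIndex m) * x (midIndex m) ^ q ^ (2 * k - 1) =
        ∑ i, (v i * z i ^ q ^ (2 * k - 1) + z i * v i ^ q ^ (2 * k - 1)) +
        w (midIndex m) * w (midIndex m) ^ q ^ (2 * k - 1) at h1
      obtain ⟨k, rfl⟩ : ∃ l, k = l + 1 := ⟨k - 1, by omega⟩
      have he : 2 * (k + 1) - 1 = 2 * k + 1 := by omega
      rw [he] at h1 ⊢
      have hqq : ∀ a : F, (a ^ q) ^ q = a := fun a => by
        rw [← pow_mul, ← sq, ← hq, FiniteField.pow_card]
      rw [hxt, add_pow_q_pow hq] at h1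
      have e1 : ∑ i, v i * (∑ i', B i' i ^ q • y i') ^ q ^ (2 * k + 1) =
          ∑ i, x (lowIndex i) * y i ^ q ^ (2 * k + 1) := by
        simp only [sum_pow_q_pow hq, smul_pow, pow_q_pow_odd hq, hqq, hxB, Finset.mul_sum,
          Finset.sum_mul]
        rw [Finset.sum_comm]
        simp only [mul_smul_comm, smul_mul_assoc]
      have e2 : ∑ i, (∑ i', B i' i ^ q • y i') * v i ^ q ^ (2 * k + 1) =
          ∑ i, y i * x (lowIndex i) ^ q ^ (2 * k + 1) := by
        simp only [sum_pow_q_pow hq, smul_pow, pow_q_pow_odd hq, hxB, Finset.mul_sum,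
          Finset.sum_mul]
        rw [Finset.sum_comm]
        simp only [mul_smul_comm, smul_mul_assoc]
      have e3 : ∑ i, v i * (s (lowIndex i) ^ q • w (midIndex m)) ^ q ^ (2 * k + 1) =
          t * w (midIndex m) ^ q ^ (2 * k + 1) := by
        simp only [smul_pow, pow_q_pow_odd hq, hqq, t, Finset.sum_mul, mul_smul_comm,
          smul_mul_assoc]
      have e4 : ∑ i, (s (lowIndex i) ^ q • w (midIndex m)) * v i ^ q ^ (2 * k + 1) =
          w (midIndex m) * t ^ q ^ (2 * k + 1) := by
        simp only [t, sum_pow_q_pow hq, smul_pow, pow_q_pow_odd hq, Finset.mul_sum, mul_smul_comm,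
          smul_mul_assoc]
      simp only [u, sub_pow_q_pow hq, mul_sub, sub_mul]
      simp only [Finset.sum_add_distrib, Finset.sum_sub_distrib] at h1 ⊢
      rw [e1, e2, e3, e4]
      linear_combination -h1
  -- Solving the definition of `u l` for `z l`.
  let T := Submodule.span F (x '' Set.Iio (lowIndex l).rev)
  have hmidlt : midIndex m < (lowIndex l).rev := by
    simp only [midIndex, lowIndex, Fin.lt_def, Fin.val_rev]
    omega
  have hxT : ∀ i, i < (lowIndex l).rev → x i ∈ T := fun i hi => Submodule.subset_span ⟨i, hi, rfl⟩
  have hle : Submodule.span F (x '' Set.Iio (midIndex m)) ≤ T :=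
    Submodule.span_mono (Set.image_mono (Set.Iio_subset_Iio hmidlt.le))
  have hvT : Submodule.span F (Set.range v) ≤ T := by
    refine le_trans ?_ hle
    rw [← hspan _ hmid]
    refine Submodule.span_mono ?_
    rintro _ ⟨i, rfl⟩
    exact ⟨lowIndex i, hlowlt i, rfl⟩
  have hwT : w (midIndex m) ∈ T := by
    have h1 := Submodule.add_mem _ (hle (hlow (midIndex m) hmid)) (hxT _ hmidlt)
    simpa [x] using h1
  have hsum : ∑ i', B i' l ^ q • y i' - y l ∈ T := by
    have hBl : B l l = 1 := by simp [B, hc l _ le_rfl]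
    rw [Fintype.sum_eq_add_sum_compl l, hBl, one_pow, one_smul, add_sub_cancel_left]
    refine Submodule.sum_mem _ fun i hi => ?_
    have hil : i ≠ l := by simpa using hi
    by_cases hlt : l < i
    · refine Submodule.smul_mem _ _ (hxT _ ?_)
      rw [Fin.rev_lt_rev]
      exact Fin.lt_def.2 (Fin.lt_def.1 hlt)
    · have hq1 := one_lt_of_card_eq_sq hq
      have : B i l = 0 := by
        simp only [B, if_neg hil, zero_add]
        exact hc i _ (Fin.le_def.2 (Fin.le_def.1 (not_lt.1 hlt)))
      rw [this, zero_pow (by omega), zero_smul]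
      exact Submodule.zero_mem _
  have hfin := Submodule.add_mem _ (Submodule.add_mem _ (hvT (hu l)) hsum)
    (Submodule.smul_mem _ (s (lowIndex l) ^ q) hwT)
  have heq : u l + (∑ i', B i' l ^ q • y i' - y l) + s (lowIndex l) ^ q • w (midIndex m) =
      z l - y l := by
    simp only [u]
    abel
  rw [heq] at hfin
  exact hfin

/-- Two embeddings of the polynomial ring into a field that agree on the generators differ by
an element of the Sylow subgroup. -/
theorem exists_polyAction_of_agree (hq : Fintype.card F = q ^ 2)
    (hf : Function.Injective f) (hg : Function.Injective g)
    (h0 : f (MvPolynomial.X 0) = g (MvPolynomial.X 0))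
    (hN : ∀ j : Fin (2 * m + 1), 1 ≤ (j : ℕ) → (j : ℕ) ≤ m →
      f (orbitProduct (unitarySylow hq m) (MvPolynomial.X j)) =
        g (orbitProduct (unitarySylow hq m) (MvPolynomial.X j)))
    (hh : ∀ k, 1 ≤ k → k ≤ m → f (hPoly F q m k) = g (hPoly F q m k)) :
    ∃ γ ∈ unitarySylow hq m, ∀ p, g p = f (polyAction F (2 * m + 1) γ p) := by
  have hlow := sub_mem_span_of_map_orbitProduct_eq hq hf hg h0 hN
  have hall : ∀ j, g (MvPolynomial.X j) - f (MvPolynomial.X j) ∈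
      Submodule.span F ((fun i => f (MvPolynomial.X i)) '' Set.Iio j) := by
    intro j
    rcases le_or_gt (j : ℕ) m with hj | hj
    · exact hlow j hj
    · have hj' : j = (lowIndex (⟨2 * m - j, by omega⟩ : Fin m)).rev := by
        simp only [lowIndex, Fin.ext_iff, Fin.val_rev]
        omega
      rw [hj']
      exact rev_sub_mem_span_of_map_hPoly_eq hq hg hlow hh _
  choose c hc hgc using fun j => exists_sum_smul_of_mem_span_Iio (hall j)
  obtain ⟨N, hNl, hNc⟩ := exists_lowerUnitriangular_eq
    (Matrix.of fun i j => (if i = j then 1 else 0) + c i j)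
    (fun i => by simp [hc i i le_rfl]) (fun i j hij => by simp [hij.ne, hc i j hij.le])
  have hgN : ∀ i, g (MvPolynomial.X i) = ∑ a, N.1 i a • f (MvPolynomial.X a) := by
    intro i
    simp only [hNc, Matrix.of_apply, add_smul, Finset.sum_add_distrib, ite_smul, one_smul,
      zero_smul, Finset.sum_ite_eq, Finset.mem_univ, if_true, ← hgc i]
    ring
  have hNu : N ∈ generalUnitaryGroup hq (2 * m + 1) := by
    rcases Nat.eq_zero_or_pos m with rfl | hm
    · -- For `m = 0` there are no `h_k`, but the only lower unitriangular matrix is `1`.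
      have : N = 1 := by
        ext i j
        rw [show i = j from Fin.ext (by omega), hNl.1 j]
        simp
      rw [this]
      exact Subgroup.one_mem _
    · exact mem_generalUnitaryGroup_of_map_hPoly_eq hq hf (hh 1 le_rfl hm) N hgN
  refine ⟨N⁻¹, (unitarySylow hq m).inv_mem ⟨hNl, hNu⟩, fun p => ?_⟩
  have : g = f.comp (polyAction F (2 * m + 1) N⁻¹).toAlgHom := by
    ext i
    change g (MvPolynomial.X i) = f (polyAction F (2 * m + 1) N⁻¹ (MvPolynomial.X i))
    rw [polyAction_X, inv_inv, hgN]
    simp only [← MvPolynomial.smul_eq_C_mul, map_sum, map_smul]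
  rw [this]
  rfl

end Agreement

/-! ### Derivations that vanish on the generators -/

section Derivations

variable {F : Type*} [Field F] [Fintype F] {q : ℕ} {m : ℕ} {Ω : Type*} [Field Ω] [Algebra F Ω]
  {f : MvPolynomial (Fin (2 * m + 1)) F →ₐ[F] Ω}

theorem derivation_X_eq_zero_of_orbitProduct (hq : Fintype.card F = q ^ 2)
    (hf : Function.Injective f) (D : Derivation F Ω Ω) (h0 : D (f (MvPolynomial.X 0)) = 0)
    (hN : ∀ j : Fin (2 * m + 1), 1 ≤ (j : ℕ) → (j : ℕ) ≤ m →
      D (f (orbitProduct (unitarySylow hq m) (MvPolynomial.X j))) = 0)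
    (j : Fin (2 * m + 1)) (hj : (j : ℕ) ≤ m) : D (f (MvPolynomial.X j)) = 0 := by
  induction j using WellFoundedLT.induction with
  | _ j ih =>
  rcases Nat.eq_zero_or_pos (j : ℕ) with hj0 | hj0
  · have : j = 0 := Fin.ext hj0
    rw [this, h0]
  · let T := Submodule.span F ((fun i => f (MvPolynomial.X i)) '' Set.Iio j)
    have : FiniteDimensional F T :=
      FiniteDimensional.span_of_finite F (Set.toFinite _)
    have : Finite T := Module.finite_of_finite F
    have : Fintype T.toAddSubgroup := @Fintype.ofFinite _ this
    have hT : T ≤ LinearMap.ker (D : Ω →ₗ[F] Ω) := by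
      rw [Submodule.span_le]
      rintro _ ⟨i, hi, rfl⟩
      exact ih i hi ((Fin.lt_def.1 hi).le.trans hj)
    apply derivation_eq_zero_of_prod_add D T.toAddSubgroup fun u hu => hT hu
    rw [← map_orbitProduct_X hq j hj f hf T.toAddSubgroup rfl, hN j hj0 hj]

/-- In characteristic `p` the differential of `h_k` is a linear combination of the differentials of
the variables, with a Moore matrix as the matrix of coefficients. -/
theorem derivation_X_eq_zero (hq : Fintype.card F = q ^ 2)
    (hf : Function.Injective f) (D : Derivation F Ω Ω) (h0 : D (f (MvPolynomial.X 0)) = 0)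
    (hN : ∀ j : Fin (2 * m + 1), 1 ≤ (j : ℕ) → (j : ℕ) ≤ m →
      D (f (orbitProduct (unitarySylow hq m) (MvPolynomial.X j))) = 0)
    (hh : ∀ k, 1 ≤ k → k ≤ m → D (f (hPoly F q m k)) = 0) (i : Fin (2 * m + 1)) :
    D (f (MvPolynomial.X i)) = 0 := by
  have hlow := derivation_X_eq_zero_of_orbitProduct hq hf D h0 hN
  let v : Fin m → Ω := fun l => f (MvPolynomial.X (lowIndex l))
  let y : Fin m → Ω := fun l => f (MvPolynomial.X (lowIndex l).rev)
  have hv : LinearIndependent F v := by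
    have h1 := (MvPolynomial.linearIndependent_X (Fin (2 * m + 1)) F).map' f.toLinearMap
      (LinearMap.ker_eq_bot.2 hf)
    exact h1.comp lowIndex fun a b h => Fin.ext (Fin.ext_iff.1 h :)
  have hpow : ∀ (a : Ω) (n : ℕ), D (a ^ q ^ (n + 1)) = 0 := by
    intro a n
    have hz : ((q ^ (n + 1) : ℕ) : Ω) = 0 := by
      have := congrArg (algebraMap F Ω) (natCast_eq_zero_of_card_eq_sq hq)
      rw [map_natCast, map_zero] at this
      rw [Nat.cast_pow, this, zero_pow n.succ_ne_zero]
    rw [Derivation.leibniz_pow, ← Nat.cast_smul_eq_nsmul Ω, hz, zero_smul]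
  have hdet : ((mooreMatrix q v).map (powHom hq Ω)).det ≠ 0 := by
    have h1 : ((mooreMatrix q v).map (powHom hq Ω)).det = powHom hq Ω (mooreMatrix q v).det :=
      (RingHom.map_det (powHom hq Ω) _).symm
    rw [h1]
    exact (map_ne_zero _).2 (det_mooreMatrix_ne_zero hq hv)
  have hy : (fun l => D (y l)) = 0 := by
    apply Matrix.eq_zero_of_mulVec_eq_zero hdet
    funext a
    have h1 := hh (a + 1) (by omega) (by omega)
    have he : 2 * ((a : ℕ) + 1) - 1 = 2 * a + 1 := by omega
    have hDv : ∀ l, D (f (MvPolynomial.X (lowIndex l))) = 0 := fun l => hlow _ l.2.le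
    rw [map_hPoly, he] at h1
    simp only [map_add, map_sum, Derivation.leibniz, hpow, hDv, hlow (midIndex m) le_rfl,
      smul_zero, add_zero, zero_add] at h1
    rw [Pi.zero_apply, ← h1, Matrix.mulVec, dotProduct]
    refine Finset.sum_congr rfl fun l _ => ?_
    simp only [mooreMatrix, Matrix.map_apply, Matrix.of_apply, powHom_apply, ← pow_mul,
      ← pow_succ, smul_eq_mul, v, y]
  rcases le_or_gt (i : ℕ) m with hi | hi
  · exact hlow i hi
  · have hi' : i = (lowIndex (⟨2 * m - i, by omega⟩ : Fin m)).rev := by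
      simp only [lowIndex, Fin.ext_iff, Fin.val_rev]
      omega
    rw [hi']
    exact congrFun hy _

end Derivations

/-! ### Separable algebraic extensions -/

section Separable

universe u

theorem isSeparable_of_forall_derivation_eq_zero {K L : Type u} [Field K] [Field L] [Algebra K L]
    [Algebra.EssFiniteType K L] (h : ∀ (D : Derivation K L L) (a : L), D a = 0) :
    Algebra.IsSeparable K L := by
  rw [← Algebra.FormallyUnramified.iff_isSeparable]
  refine ⟨subsingleton_of_forall_eq 0 fun ω => ?_⟩
  rw [← Module.forall_dual_apply_eq_zero_iff L]
  intro φ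
  have hφ : φ.compDer (KaehlerDifferential.D K L) = 0 := Derivation.ext fun a => h _ a
  have : φ = 0 := (KaehlerDifferential.linearMapEquivDerivation K L).injective (by
    rw [map_zero]
    exact hφ)
  rw [this, LinearMap.zero_apply]

theorem mem_range_algebraMap_of_forall_algHom_eq {K L Ω : Type*} [Field K] [Field L] [Algebra K L]
    [Algebra.IsSeparable K L] [Field Ω] [IsAlgClosed Ω] [Algebra K Ω] [Algebra L Ω]
    [IsScalarTower K L Ω] {a : L} (h : ∀ σ : L →ₐ[K] Ω, σ a = algebraMap L Ω a) :
    a ∈ (algebraMap K L).range := by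
  rw [← minpoly.natDegree_eq_one_iff,
    ← Polynomial.card_rootSet_eq_natDegree (K := Ω) (Algebra.IsSeparable.isSeparable K a)
      (IsAlgClosed.splits _), Fintype.card_eq_one_iff]
  have hr := Algebra.IsAlgebraic.range_eval_eq_rootSet_minpoly (F := K) (K := L) Ω a
  refine ⟨⟨algebraMap L Ω a, ?_⟩, ?_⟩
  · rw [← hr]
    exact ⟨IsScalarTower.toAlgHom K L Ω, rfl⟩
  · rintro ⟨b, hb⟩
    rw [← hr] at hb
    obtain ⟨σ, rfl⟩ := hb
    exact Subtype.ext (h σ)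

end Separable

/-! ### The field of invariants -/

section Invariants

variable {F : Type*} [Field F]

theorem mem_invariantField_iff {n : ℕ} {G : Subgroup (GL (Fin n) F)} {a : RatFunField F n} :
    a ∈ invariantField G ↔ ∀ g ∈ G,
      IsFractionRing.fieldEquivOfAlgEquivHom F (RatFunField F n) (polyAction F n g) a = a := by
  rw [invariantField, IntermediateField.mem_fixedField_iff]
  constructor
  · exact fun h g hg => h _ ⟨g, hg, rfl⟩
  · rintro h _ ⟨g, hg, rfl⟩
    exact h g hg

theorem fieldEquiv_algebraMap {n : ℕ} (g : GL (Fin n) F) (p : MvPolynomial (Fin n) F) :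
    IsFractionRing.fieldEquivOfAlgEquivHom F (RatFunField F n) (polyAction F n g)
      (algebraMap _ (RatFunField F n) p) = algebraMap _ _ (polyAction F n g p) := by
  simp

theorem ringHom_ratFunField_ext {n : ℕ} {Ω : Type*} [Field Ω] {σ τ : RatFunField F n →+* Ω}
    (h : ∀ p : MvPolynomial (Fin n) F, σ (algebraMap _ _ p) = τ (algebraMap _ _ p)) : σ = τ :=
  IsLocalization.ringHom_ext (nonZeroDivisors (MvPolynomial (Fin n) F)) (RingHom.ext h)

theorem derivation_ratFunField_eq_zero {n : ℕ} {D : Derivation F (RatFunField F n) (RatFunField F n)}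
    (h : ∀ i, D (algebraMap (MvPolynomial (Fin n) F) _ (MvPolynomial.X i)) = 0)
    (a : RatFunField F n) : D a = 0 := by
  have hp : ∀ p : MvPolynomial (Fin n) F, D (algebraMap _ _ p) = 0 := by
    intro p
    induction p using MvPolynomial.induction_on with
    | C c =>
      rw [← MvPolynomial.algebraMap_eq, ← IsScalarTower.algebraMap_apply]
      exact D.map_algebraMap c
    | add p r hp hr => rw [map_add, map_add, hp, hr, add_zero]
    | mul_X p i hp => rw [map_mul, Derivation.leibniz, hp, h, smul_zero, smul_zero, add_zero]
  obtain ⟨p, r, hr, rfl⟩ := IsFractionRing.div_surjective (A := MvPolynomial (Fin n) F) a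
  have hr0 : algebraMap (MvPolynomial (Fin n) F) (RatFunField F n) r ≠ 0 :=
    IsFractionRing.to_map_ne_zero_of_mem_nonZeroDivisors hr
  have h1 := hp p
  rw [← div_mul_cancel₀ (algebraMap (MvPolynomial (Fin n) F) (RatFunField F n) p) hr0,
    Derivation.leibniz, hp r, smul_zero, zero_add, smul_eq_mul] at h1
  exact (mul_eq_zero.1 h1).resolve_left hr0

theorem polyAction_orbitProduct [Finite F] {n : ℕ} {G : Subgroup (GL (Fin n) F)}
    {g : GL (Fin n) F} (hg : g ∈ G) (p : MvPolynomial (Fin n) F) :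
    polyAction F n g (orbitProduct G p) = orbitProduct G p := by
  have hfin : (Set.range fun h : G => polyAction F n h p).Finite := Set.finite_range _
  have himage : polyAction F n g '' Set.range (fun h : G => polyAction F n h p) =
      Set.range (fun h : G => polyAction F n h p) := by
    rw [← Set.range_comp]
    refine Set.Subset.antisymm ?_ ?_
    · rintro _ ⟨h, rfl⟩
      exact ⟨⟨g, hg⟩ * h, by simp⟩
    · rintro _ ⟨h, rfl⟩
      refine ⟨⟨g, hg⟩⁻¹ * h, ?_⟩
      simp only [Function.comp_apply, ← AlgEquiv.mul_apply, ← map_mul]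
      simp
  conv_rhs => rw [orbitProduct, ← himage]
  rw [finprod_mem_image (polyAction F n g).injective.injOn, orbitProduct]
  exact MonoidHom.map_finprod_mem (f := fun u => u)
    (polyAction F n g : MvPolynomial (Fin n) F →* MvPolynomial (Fin n) F) hfin

end Invariants

theorem mainTheorem2 {F : Type*} [Field F] [Fintype F] (q : ℕ)
    (hq : Fintype.card F = q ^ 2) (m : ℕ) :
    invariantField (unitarySylow hq m) =
      IntermediateField.adjoin F
        (algebraMap (MvPolynomial (Fin (2 * m + 1)) F) (RatFunField F (2 * m + 1)) ''
          ({MvPolynomial.X 0} ∪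
            {f | ∃ j : Fin (2 * m + 1), 1 ≤ (j : ℕ) ∧ (j : ℕ) ≤ m ∧
              f = orbitProduct (unitarySylow hq m) (MvPolynomial.X j)} ∪
            {f | ∃ k : ℕ, 1 ≤ k ∧ k ≤ m ∧ f = hPoly F q m k})) := by
  apply le_antisymm
  · set S : Set (MvPolynomial (Fin (2 * m + 1)) F) := {MvPolynomial.X 0} ∪
      {f | ∃ j : Fin (2 * m + 1), 1 ≤ (j : ℕ) ∧ (j : ℕ) ≤ m ∧
        f = orbitProduct (unitarySylow hq m) (MvPolynomial.X j)} ∪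
      {f | ∃ k : ℕ, 1 ≤ k ∧ k ≤ m ∧ f = hPoly F q m k}
    have h0 : MvPolynomial.X 0 ∈ S := Or.inl (Or.inl rfl)
    have hN : ∀ j : Fin (2 * m + 1), 1 ≤ (j : ℕ) → (j : ℕ) ≤ m →
        orbitProduct (unitarySylow hq m) (MvPolynomial.X j) ∈ S :=
      fun j h1 h2 => Or.inl (Or.inr ⟨j, h1, h2, rfl⟩)
    have hh : ∀ k, 1 ≤ k → k ≤ m → hPoly F q m k ∈ S := fun k h1 h2 => Or.inr ⟨k, h1, h2, rfl⟩
    let L := RatFunField F (2 * m + 1)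
    let K := IntermediateField.adjoin F (algebraMap _ L '' S)
    let ι : MvPolynomial (Fin (2 * m + 1)) F →ₐ[F] L := Algebra.algHom F _ L
    have hι : Function.Injective ι := IsFractionRing.injective _ L
    have hSK : ∀ p ∈ S, ∃ c : K, algebraMap K L c = ι p := fun p hp =>
      ⟨⟨_, IntermediateField.subset_adjoin F _ ⟨p, hp, rfl⟩⟩, rfl⟩
    have : Algebra.EssFiniteType F L := by
      have := Algebra.EssFiniteType.of_isLocalization L
        (nonZeroDivisors (MvPolynomial (Fin (2 * m + 1)) F))
      exact Algebra.EssFiniteType.comp F (MvPolynomial (Fin (2 * m + 1)) F) L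
    have : Algebra.EssFiniteType K L := Algebra.EssFiniteType.of_comp F K L
    have : Algebra.IsSeparable K L := by
      apply isSeparable_of_forall_derivation_eq_zero
      intro D
      have hD : ∀ p ∈ S, D.restrictScalars F (ι p) = 0 := by
        intro p hp
        obtain ⟨c, hc⟩ := hSK p hp
        rw [← hc]
        exact D.map_algebraMap c
      exact derivation_ratFunField_eq_zero (D := D.restrictScalars F)
        (derivation_X_eq_zero hq hι _ (hD _ h0) (fun j h1 h2 => hD _ (hN j h1 h2))
          fun k h1 h2 => hD _ (hh k h1 h2))
    intro a ha
    rw [mem_invariantField_iff] at ha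
    let Ω := AlgebraicClosure L
    have hrange : a ∈ (algebraMap K L).range := by
      apply mem_range_algebraMap_of_forall_algHom_eq (Ω := Ω)
      intro σ
      let f : MvPolynomial (Fin (2 * m + 1)) F →ₐ[F] Ω := (IsScalarTower.toAlgHom F L Ω).comp ι
      let g : MvPolynomial (Fin (2 * m + 1)) F →ₐ[F] Ω := (σ.restrictScalars F).comp ι
      have hfg : ∀ p ∈ S, f p = g p := by
        intro p hp
        obtain ⟨c, hc⟩ := hSK p hp
        change algebraMap L Ω (ι p) = σ (ι p)
        rw [← hc, AlgHom.commutes, ← IsScalarTower.algebraMap_apply]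
      obtain ⟨γ, hγ, hγ'⟩ := exists_polyAction_of_agree hq (f := f) (g := g)
        ((algebraMap L Ω).injective.comp hι) (σ.toRingHom.injective.comp hι)
        (hfg _ h0) (fun j h1 h2 => hfg _ (hN j h1 h2)) fun k h1 h2 => hfg _ (hh k h1 h2)
      have hσ : σ.toRingHom = (algebraMap L Ω).comp
          (IsFractionRing.fieldEquivOfAlgEquivHom F L (polyAction F _ γ) : L →+* L) := by
        apply ringHom_ratFunField_ext
        intro p
        refine (hγ' p).trans ?_
        exact congrArg (algebraMap L Ω) (fieldEquiv_algebraMap γ p).symm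
      have := DFunLike.congr_fun hσ a
      refine this.trans ?_
      exact congrArg (algebraMap L Ω) (ha γ hγ)
    obtain ⟨c, rfl⟩ := hrange
    exact c.2
  · rw [IntermediateField.adjoin_le_iff]
    rintro _ ⟨p, hp, rfl⟩
    change _ ∈ invariantField _
    rw [mem_invariantField_iff]
    intro g hg
    rw [fieldEquiv_algebraMap]
    congr 1
    rcases hp with (rfl | ⟨j, -, -, rfl⟩) | ⟨k, hk, -, rfl⟩
    · have hg' := ((unitarySylow hq m).inv_mem hg).1
      rw [polyAction_X, Finset.sum_eq_single 0, hg'.1, MvPolynomial.C_1, one_mul]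
      · intro j _ hj
        rw [hg'.2 0 j (Fin.pos_iff_ne_zero.2 hj), MvPolynomial.C_0, zero_mul]
      · simp
    · exact polyAction_orbitProduct hg _
    · exact polyAction_hPoly hq hk hg.2
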